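/- Let $\mathbb{k}$ be a field, $q\in\mathbb{k}\setminus\{0,1\}$, $m,\ell\ge 0$ integers and $Q_1,\dots,Q_\ell\in\mathbb{k}\setminus\{0\}$. We work over one of the following base rings $S$ with parameters $\mathsf{q},\mathsf{Q}_1,\dots,\mathsf{Q}_\ell\in S$: (a) (deformed case, $\operatorname{char}\mathbb{k}=0$) $S=\mathbb{k}[[h,z_1,\dots,z_\ell]]$, $\mathsf{q}=q\,d(h)$ with $d(h)\in 1+h\,\mathbb{k}[[h]]$, and $\mathsf{Q}_i=Q_ie^{-z_i}$; (b) (undeformed case, arbitrary characteristic) $S=\mathbb{k}$, $\mathsf{q}=q$, $\mathsf{Q}_i=Q_i$. Put $p(A)=\prod_{i=1}^{\ell}(A-\mathsf{Q}_i)$. **Cyclotomic affine Hecke (Ariki–Koike) algebra.** Let $\mathcal{H}$ be the $S$-algebra generated by $X_1^{\pm1},\dots,X_m^{\pm1},T_1,\dots,T_{m-1}$ subject to: the $X_r^{\pm1}$ commute; $T_r^2=(\mathsf{q}-1)T_r+\mathsf{q}$; $T_rX_rT_r=\mathsf{q}X_{r+1}$; $T_rT_{r+1}T_r=T_{r+1}T_rT_{r+1}$;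 $T_rX_s=X_sT_r$ for $s\ne r,r+1$; $T_rT_s=T_sT_r$ for $r\neq s\pm1$. Let $\mathcal{H}^{Q_\bullet}$ be the quotient of $\mathcal{H}$ by the two-sided ideal generated by $p(X_1)$ (by the zero ideal if $m=0$). **Type F$_1$ Hecke algebra.** A type F$_1$ Hecke diagram consists of $m$ green strands in $\mathbb{R}\times[0,1]$, each projecting diffeomorphically to $[0,1]$ and carrying finitely many squares and formal inverse squares, together with a vertical red line at $x=0$; there are no tangencies or triple points, endpoints avoid the red line, and no square lies on a crossing. Diagrams are taken up to isotopies (fixing the endpoints) which preserve these conditions, and a square cancels an adjacent inverse square on the same strand. The product $ab$ stacks $a$ on top of $b$, and is $0$ if the top of $b$ is not equal to the bottom of $a$. For an $m$-element set $B\subset\mathbb{R}\setminus\{0\}$, let $e_B$ be the diagram of vertical green strands through $B$. Let $\tilde{F}$ be the $S$-algebra (without unit) spanned by these diagrams modulo the following local relations: 1. for neighbouring green strands with indices $r,r+1$ from the left, not separated by the red line, $\psi_r$ denoting their crossing and $X_r$ a square on the $r$th strand: $X_r\psi_r-\psi_rX_{r+1}=X_r-\mathsf{q}X_{r+1}=\psi_rX_r-X_{r+1}\psi_r$,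 $\ \psi_r^2=(1+\mathsf{q})\psi_r$, and, for three neighbouring green strands, $\psi_r\psi_{r+1}\psi_r-\psi_{r+1}\psi_r\psi_{r+1}=\mathsf{q}(\psi_r-\psi_{r+1})$; 2. a green strand (the $j$th from the left) which crosses the red line and immediately crosses back, from either side, equals $p(X_j)$ times the vertical strand; 3. a square passes freely through a crossing with the red line; a crossing of two green strands which both cross the red line in the same direction passes freely through the red line; 4. if neighbouring green strands $i,i+1$ lie on opposite sides of the red line and are exchanged, the diagram in which they cross each other right of the red line minus the diagram in which they cross each other left of it equals $$\sum_{k=1}^{\ell}\ \sum_{a+b=k-1}\mathsf{e}_{\ell-k}(-\mathsf{Q}_1,\dots,-\mathsf{Q}_\ell)\,\bigl(X_i^{a+1}X_{i+1}^{b}-\mathsf{q}\,X_i^{a}X_{i+1}^{b+1}\bigr)=(X_i-\mathsf{q}X_{i+1})\frac{p(X_i)-p(X_{i+1})}{X_i-X_{i+1}}$$ times the diagram of vertical strands, where $\mathsf{e}_k$ is the $k$th elementary symmetric function. The type F$_1$ Hecke algebra $F$ is the quotient of $\tilde F$ by the two-sided ideal (the violating ideal) generated by all $e_B$ such that $B$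 contains a negative number. For a collection $\mathscr{D}$ of $m$-element subsets of $\mathbb{R}\setminus\{0\}$ let $F_{\mathscr{D}}\subset F$ be the subalgebra spanned by the diagrams whose tops and bottoms lie in $\mathscr{D}$. **Proposition.** Let $\mathscr{D}^\circ=\{B_0,\dots,B_m\}$, where $B_i\subset\mathbb{R}\setminus\{0\}$ is an arbitrarily chosen set with $i$ negative and $m-i$ positive elements. Then in both cases (a) and (b) there is an isomorphism of $S$-algebras $$\mathcal{H}^{Q_\bullet}\;\cong\;F_{\mathscr{D}^\circ}.$$ -/

import Mathlib

open scoped Polynomial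

noncomputable section

/-! ### Affine and cyclotomic Hecke algebras -/

namespace Hecke

/-- Generators of the affine Hecke algebra of rank `m` (indices start at `0`). -/
inductive Gen (m : ℕ) : Type
  | X (i : Fin m) : Gen m
  | Xinv (i : Fin m) : Gen m
  | T (r : ℕ) (h : r + 1 < m) : Gen m

variable (S : Type*) [CommRing S] (q : S) (m : ℕ)

/-- The generator attached to `g` in the free algebra. -/
abbrev gen {m : ℕ} (g : Gen m) : FreeAlgebra S (Gen m) := FreeAlgebra.ι S g

open Gen in
/-- The defining relations of the affine Hecke algebra with parameter `q`. -/
inductive Rel : FreeAlgebra S (Gen m) → FreeAlgebra S (Gen m) → Prop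
  | X_mul_Xinv (i : Fin m) : Rel (gen S (X i) * gen S (Xinv i)) 1
  | Xinv_mul_X (i : Fin m) : Rel (gen S (Xinv i) * gen S (X i)) 1
  | X_X (i j : Fin m) : Rel (gen S (X i) * gen S (X j)) (gen S (X j) * gen S (X i))
  | X_Xinv (i j : Fin m) : Rel (gen S (X i) * gen S (Xinv j)) (gen S (Xinv j) * gen S (X i))
  | Xinv_Xinv (i j : Fin m) :
      Rel (gen S (Xinv i) * gen S (Xinv j)) (gen S (Xinv j) * gen S (Xinv i))
  | T_sq (r : ℕ) (h : r + 1 < m) :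
      Rel (gen S (T r h) * gen S (T r h))
        ((q - 1) • gen S (T r h) + algebraMap S (FreeAlgebra S (Gen m)) q)
  | T_X_T (r : ℕ) (h : r + 1 < m) :
      Rel (gen S (T r h) * gen S (X ⟨r, Nat.lt_of_succ_lt h⟩) * gen S (T r h))
        (q • gen S (X ⟨r + 1, h⟩))
  | braid (r : ℕ) (h : r + 1 < m) (h' : r + 1 + 1 < m) :
      Rel (gen S (T r h) * gen S (T (r + 1) h') * gen S (T r h))
        (gen S (T (r + 1) h') * gen S (T r h) * gen S (T (r + 1) h'))
  | T_X (r : ℕ) (h : r + 1 < m) (s : Fin m) (h₁ : (s : ℕ) ≠ r) (h₂ : (s : ℕ) ≠ r + 1) :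
      Rel (gen S (T r h) * gen S (X s)) (gen S (X s) * gen S (T r h))
  | T_T (r s : ℕ) (h : r + 1 < m) (h' : s + 1 < m) (h₁ : r ≠ s + 1) (h₂ : s ≠ r + 1) :
      Rel (gen S (T r h) * gen S (T s h')) (gen S (T s h') * gen S (T r h))

/-- The affine Hecke algebra of rank `m` over `S` with parameter `q`. -/
abbrev Affine : Type _ := RingQuot (Rel S q m)

/-- The generator `X_i` in the affine Hecke algebra. -/
def Affine.X (i : Fin m) : Affine S q m := RingQuot.mkAlgHom S (Rel S q m) (gen S (Gen.X i))

variable {ℓ : ℕ} (P : Fin ℓ → S)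

/-- The polynomial `(A - P_1) ⋯ (A - P_ℓ)`. -/
def cycPoly {S : Type*} [CommRing S] {ℓ : ℕ} (P : Fin ℓ → S) : S[X] :=
  ∏ i, (Polynomial.X - Polynomial.C (P i))

/-- The relation `C(X_1) = 0`, where `C(A) = (A - P_1) ⋯ (A - P_ℓ)` and `X_1` is the first
generator (there is none when `m = 0`). -/
inductive CycRel : Affine S q m → Affine S q m → Prop
  | cyc (h : 0 < m) : CycRel (Polynomial.aeval (Affine.X S q m ⟨0, h⟩) (cycPoly P)) 0

/-- The cyclotomic affine Hecke (Ariki-Koike) algebra: the quotient of the affine Hecke algebra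
by the two-sided ideal generated by `C(X_1)`. -/
abbrev Cyclotomic : Type _ := RingQuot (CycRel S q m P)

end Hecke

/-! ### Diagrams with one red line

Diagrams are drawn in `ℝ × [0,1]`, with the red line vertical at `x = 0`, and read from bottom to
top; a product `a * b` places `a` on top of `b`.  A diagram is cut by horizontal lines into slices,
each consisting of straight strands with at most one crossing, or of vertical strands with one
square or inverse square.  Isotopies which avoid tangencies and triple points, and do not move
squares through crossings, become the relations `comp`, `far`, `square_comm`, `square_id`,
`id_square` and `slide` below. -/

namespace TypeF

/-- The endpoints of the `m` green strands on a horizontal line: an `m`-element subset of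
`ℝ` which avoids the red line. -/
structure Config (m : ℕ) : Type where
  pts : Finset ℝ
  card_pts : pts.card = m
  zero_notMem : (0 : ℝ) ∉ pts

variable {m : ℕ}

/-- The strands meeting a horizontal line: `some b` is the green strand at `b`, and `none` is
the red line. -/
abbrev Config.Strand (B : Config m) : Type := Option B.pts

/-- The `x`-coordinate of a strand. -/
def Config.pos (B : Config m) : B.Strand → ℝ
  | none => 0
  | some b => (b : ℝ)

/-- The number of green strands to the left of the red line. -/
def Config.numLeft (B : Config m) : ℕ := (B.pts.filter (fun b => b < 0)).card

/-- The matching of green endpoints, extended to the red line. -/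
def extend {B C : Config m} (σ : B.pts ≃ C.pts) : B.Strand ≃ C.Strand := Equiv.optionCongr σ

/-- The crossings of the straight-line diagram joining each `b ∈ B` at the bottom to `σ b ∈ C` at
the top: the unordered pairs of strands (green or red), named by their bottom ends, whose order
at the top is opposite to that at the bottom. -/
def crossings {B C : Config m} (σ : B.pts ≃ C.pts) : Set (Sym2 B.Strand) :=
  Sym2.fromRel (r := fun x y =>
      (B.pos x - B.pos y) * (C.pos (extend σ x) - C.pos (extend σ y)) < 0)
    (by constructor; intro x y h; nlinarith)

/-- A slice of a diagram: straight green strands with at most one crossing (of two green strands,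
or of a green strand with the red line), or vertical strands with a square (`pos = true`) or an
inverse square (`pos = false`) on one of them. -/
inductive Slice (m : ℕ) : Type
  | strands (B C : Config m) (σ : B.pts ≃ C.pts) (h : (crossings σ).Subsingleton) : Slice m
  | square (B : Config m) (b : B.pts) (pos : Bool) : Slice m

/-- The bottom of a slice. -/
def Slice.bot : Slice m → Config m
  | .strands B _ _ _ => B
  | .square B _ _ => B

/-- The top of a slice. -/
def Slice.top : Slice m → Config m
  | .strands _ C _ _ => C
  | .square B _ _ => B

theorem mk_mem_crossings {B C : Config m} (σ : B.pts ≃ C.pts) (x y : B.Strand) :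
    s(x, y) ∈ crossings σ ↔
      (B.pos x - B.pos y) * (C.pos (extend σ x) - C.pos (extend σ y)) < 0 := Iff.rfl

theorem crossings_refl (B : Config m) : crossings (Equiv.refl B.pts) = ∅ := by
  ext z
  induction z using Sym2.ind with
  | _ x y =>
    rw [mk_mem_crossings]
    simpa [extend] using mul_self_nonneg (B.pos x - B.pos y)

section Algebra

variable (S : Type*) [CommRing S]

/-- Straight green strands with at most one crossing, in the free algebra. -/
abbrev str {B C : Config m} (σ : B.pts ≃ C.pts) (h : (crossings σ).Subsingleton) :
    FreeAlgebra S (Slice m) := FreeAlgebra.ι S (Slice.strands B C σ h)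

/-- The square on the strand at `b`, in the free algebra. -/
abbrev sq (B : Config m) (b : B.pts) : FreeAlgebra S (Slice m) :=
  FreeAlgebra.ι S (Slice.square B b true)

/-- The square (`pos = true`) or inverse square (`pos = false`) on the strand at `b`, in the free
algebra. -/
abbrev sqs (B : Config m) (b : B.pts) (pos : Bool) : FreeAlgebra S (Slice m) :=
  FreeAlgebra.ι S (Slice.square B b pos)

theorem subsingleton_refl (B : Config m) : (crossings (Equiv.refl B.pts)).Subsingleton := by
  rw [crossings_refl]; exact Set.subsingleton_empty

/-- The idempotent `e_B` of vertical strands through `B`, in the free algebra. -/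
abbrev idem (B : Config m) : FreeAlgebra S (Slice m) :=
  str S (Equiv.refl B.pts) (subsingleton_refl B)

variable (q : S) {ℓ : ℕ} (P : Fin ℓ → S) (m)

/-- The relations of the type F₁ affine Hecke algebra. -/
inductive Rel : FreeAlgebra S (Slice m) → FreeAlgebra S (Slice m) → Prop
  -- Stacking and isotopy.
  /-- Diagrams whose ends do not match have product zero. -/
  | mismatch (g g' : Slice m) (h : g.bot ≠ g'.top) :
      Rel (FreeAlgebra.ι S g * FreeAlgebra.ι S g') 0
  /-- Strands may be straightened. -/
  | comp (B C D : Config m) (σ : B.pts ≃ C.pts) (τ : C.pts ≃ D.pts)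
      (hσ : (crossings σ).Subsingleton) (hτ : (crossings τ).Subsingleton)
      (h : crossings σ = ∅ ∨ crossings τ = ∅) (hστ : (crossings (σ.trans τ)).Subsingleton) :
      Rel (str S τ hτ * str S σ hσ) (str S (σ.trans τ) hστ)
  /-- Two crossings without a common strand may be moved past each other vertically. -/
  | far (B C C' D : Config m) (σ : B.pts ≃ C.pts) (τ : C.pts ≃ D.pts)
      (σ' : B.pts ≃ C'.pts) (τ' : C'.pts ≃ D.pts)
      (hσ : (crossings σ).Subsingleton) (hτ : (crossings τ).Subsingleton)
      (hσ' : (crossings σ').Subsingleton) (hτ' : (crossings τ').Subsingleton)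
      (h : σ.trans τ = σ'.trans τ') (u v : Sym2 B.Strand) (huv : ∀ x ∈ u, x ∉ v)
      (h₁ : crossings σ = {u}) (h₂ : crossings τ = {v.map (extend σ)})
      (h₁' : crossings σ' = {v}) (h₂' : crossings τ' = {u.map (extend σ')}) :
      Rel (str S τ hτ * str S σ hσ) (str S τ' hτ' * str S σ' hσ')
  | id_square (B : Config m) (b : B.pts) (p : Bool) : Rel (idem S B * sqs S B b p) (sqs S B b p)
  | square_id (B : Config m) (b : B.pts) (p : Bool) : Rel (sqs S B b p * idem S B) (sqs S B b p)
  | square_comm (B : Config m) (b c : B.pts) (p p' : Bool) :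
      Rel (sqs S B b p * sqs S B c p') (sqs S B c p' * sqs S B b p)
  /-- A square may be moved along a strand that meets no crossing. -/
  | slide (B C : Config m) (σ : B.pts ≃ C.pts) (hσ : (crossings σ).Subsingleton)
      (b : B.pts) (p : Bool) (h : ∀ u ∈ crossings σ, some b ∉ u) :
      Rel (sqs S C (σ b) p * str S σ hσ) (str S σ hσ * sqs S B b p)
  /-- An inverse square cancels a square. -/
  | square_inv (B : Config m) (b : B.pts) (p : Bool) :
      Rel (sqs S B b p * sqs S B b (!p)) (idem S B)
  -- Local relations between green strands.  Below, `str S (swap a b)` is the crossing of the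
  -- strands at `a` and `b`, which are neighbours because there is no other crossing.
  | hecke_top (B : Config m) (a b : B.pts) (hab : a < b)
      (h : (crossings (Equiv.swap a b)).Subsingleton) :
      Rel (sq S B a * str S (Equiv.swap a b) h - str S (Equiv.swap a b) h * sq S B b)
        (sq S B a - q • sq S B b)
  | hecke_bot (B : Config m) (a b : B.pts) (hab : a < b)
      (h : (crossings (Equiv.swap a b)).Subsingleton) :
      Rel (str S (Equiv.swap a b) h * sq S B a - sq S B b * str S (Equiv.swap a b) h)
        (sq S B a - q • sq S B b)
  | bigon (B : Config m) (a b : B.pts) (hab : a < b)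
      (h : (crossings (Equiv.swap a b)).Subsingleton) :
      Rel (str S (Equiv.swap a b) h * str S (Equiv.swap a b) h)
        ((1 + q) • str S (Equiv.swap a b) h)
  | triple (B : Config m) (a b c : B.pts) (hab : a < b) (hbc : b < c)
      (h : (crossings (Equiv.swap a b)).Subsingleton)
      (h' : (crossings (Equiv.swap b c)).Subsingleton) :
      Rel (str S (Equiv.swap a b) h * str S (Equiv.swap b c) h' * str S (Equiv.swap a b) h
          - str S (Equiv.swap b c) h' * str S (Equiv.swap a b) h * str S (Equiv.swap b c) h')
        (q • str S (Equiv.swap a b) h - q • str S (Equiv.swap b c) h')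
  -- Local relations between green strands and the red line.
  /-- A green strand that crosses the red line and comes back (from either side). -/
  | red_bigon (B C : Config m) (σ : B.pts ≃ C.pts) (hσ : (crossings σ).Subsingleton)
      (hσ' : (crossings σ.symm).Subsingleton) (a : B.pts)
      (h : crossings σ = {s(none, some a)}) :
      Rel (str S σ.symm hσ' * str S σ hσ) (Polynomial.aeval (sq S B a) (Hecke.cycPoly P) * idem S B)
  /-- A square moves freely through a crossing with the red line. -/
  | red_square (B C : Config m) (σ : B.pts ≃ C.pts) (hσ : (crossings σ).Subsingleton)
      (a : B.pts) (p : Bool) (h : crossings σ = {s(none, some a)}) :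
      Rel (sqs S C (σ a) p * str S σ hσ) (str S σ hσ * sqs S B a p)
  /-- If the strands at `a` and `b` cross the red line in the same direction (`a` before `b`),
  their mutual crossing moves freely through the red line. -/
  | red_through (B C D : Config m) (ρ : B.pts ≃ C.pts) (ρ' : C.pts ≃ D.pts)
      (hρ : (crossings ρ).Subsingleton) (hρ' : (crossings ρ').Subsingleton)
      (a b : B.pts) (hab : 0 < (a : ℝ) * (b : ℝ)) (hne : a ≠ b)
      (h₁ : crossings ρ = {s(none, some a)}) (h₂ : crossings ρ' = {s(none, some (ρ b))})
      (h : (crossings (Equiv.swap a b)).Subsingleton)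
      (h' : (crossings (Equiv.swap (ρ' (ρ a)) (ρ' (ρ b)))).Subsingleton) :
      Rel (str S ρ' hρ' * str S ρ hρ * str S (Equiv.swap a b) h)
        (str S (Equiv.swap (ρ' (ρ a)) (ρ' (ρ b))) h' * str S ρ' hρ' * str S ρ hρ)
  /-- The strands at `a < 0 < b` are exchanged, crossing each other to the right of the red
  line in the first term and to the left of it in the second; the coefficient of `A ^ i` in
  `(A - P_1) ⋯ (A - P_ℓ)` is the elementary symmetric function `e_{ℓ-i}(-P_1, …, -P_ℓ)`. -/
  | red_triple (B C D : Config m) (σ : B.pts ≃ C.pts) (τ : B.pts ≃ D.pts)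
      (hσ : (crossings σ).Subsingleton) (hσ' : (crossings σ.symm).Subsingleton)
      (hτ : (crossings τ).Subsingleton) (hτ' : (crossings τ.symm).Subsingleton)
      (a b : B.pts) (ha : (a : ℝ) < 0) (hb : 0 < (b : ℝ))
      (h₁ : crossings σ = {s(none, some a)}) (h₂ : crossings τ = {s(none, some b)})
      (h : (crossings (Equiv.swap (σ a) (σ b))).Subsingleton)
      (h' : (crossings (Equiv.swap (τ a) (τ b))).Subsingleton) :
      Rel (str S σ.symm hσ' * str S (Equiv.swap (σ a) (σ b)) h * str S σ hσ
          - str S τ.symm hτ' * str S (Equiv.swap (τ a) (τ b)) h' * str S τ hτ)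
        (∑ i ∈ Finset.Icc 1 ℓ, ∑ uv ∈ Finset.HasAntidiagonal.antidiagonal (i - 1),
          (Hecke.cycPoly P).coeff i •
            ((sq S B a ^ (uv.1 + 1) * sq S B b ^ uv.2
              - q • (sq S B a ^ uv.1 * sq S B b ^ (uv.2 + 1))) * idem S B))

/-- The type F₁ affine Hecke algebra with a formal unit adjoined.  (The algebra spanned by the
diagrams has infinitely many orthogonal idempotents `e_B` and no unit; it is the span of the
diagrams `IsDiagram`.) -/
abbrev AffineAlg : Type _ := RingQuot (Rel m S q P)

/-- The idempotent `e_B` in the type F₁ affine Hecke algebra. -/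
def AffineAlg.e (B : Config m) : AffineAlg m S q P :=
  RingQuot.mkAlgHom S (Rel m S q P) (idem S B)

/-- The relations `e_B = 0` for all `B` which possess a point left of the red line. -/
inductive Violating : AffineAlg m S q P → AffineAlg m S q P → Prop
  | violating (B : Config m) (h : ∃ b ∈ B.pts, b < 0) : Violating (AffineAlg.e m S q P B) 0

/-- The type F₁ Hecke algebra: the quotient of the affine one by the violating ideal, the
two-sided ideal generated by the violating `e_B` (again with a formal unit adjoined). -/
abbrev Alg : Type _ := RingQuot (Violating m S q P)

/-- The image in the type F₁ Hecke algebra of a single slice. -/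
def Alg.slice (g : Slice m) : Alg m S q P :=
  RingQuot.mkAlgHom S (Violating m S q P)
    (RingQuot.mkAlgHom S (Rel m S q P) (FreeAlgebra.ι S g))

/-- `IsDiagram B C x`: the element `x` of the type F₁ Hecke algebra is the class of a diagram with
bottom `B` and top `C`. -/
inductive IsDiagram : Config m → Config m → Alg m S q P → Prop
  | slice (g : Slice m) : IsDiagram g.bot g.top (Alg.slice m S q P g)
  | stack (B C D : Config m) (x y : Alg m S q P) (hx : IsDiagram B C x) (hy : IsDiagram C D y) :
      IsDiagram B D (y * x)

variable {m S q P}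

theorem slice_mul_slice_eq_zero {g g' : Slice m} (h : g.bot ≠ g'.top) :
    Alg.slice m S q P g * Alg.slice m S q P g' = 0 := by
  have := RingQuot.mkAlgHom_rel S (Rel.mismatch (m := m) (S := S) (q := q) (P := P) g g' h)
  unfold Alg.slice
  rw [← map_mul, ← map_mul, this, map_zero, map_zero]

theorem IsDiagram.slice_mul_eq_zero {B C : Config m} {x : Alg m S q P}
    (hx : IsDiagram m S q P B C x) (g : Slice m) (h : g.bot ≠ C) :
    Alg.slice m S q P g * x = 0 := by
  induction hx with
  | slice g' => exact slice_mul_slice_eq_zero h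
  | stack B C D x y _ _ _ ihy => rw [← mul_assoc, ihy h, zero_mul]

theorem IsDiagram.mul_eq_zero {B C B' C' : Config m} {x y : Alg m S q P}
    (hx : IsDiagram m S q P B C x) (hy : IsDiagram m S q P B' C' y) (h : B' ≠ C) :
    y * x = 0 := by
  induction hy with
  | slice g => exact hx.slice_mul_eq_zero g h
  | stack B' C' D' y y' _ _ ihy _ => rw [mul_assoc, ihy h, mul_zero]

variable (m S q P)

/-- The subalgebra of the type F₁ Hecke algebra spanned by the diagrams whose tops and bottoms lie
in the collection `𝒟`. -/
def Sub (𝒟 : Set (Config m)) : NonUnitalSubalgebra S (Alg m S q P) :=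
  Submodule.toNonUnitalSubalgebra
    (Submodule.span S {x | ∃ B ∈ 𝒟, ∃ C ∈ 𝒟, IsDiagram m S q P B C x})
    (by
      intro x y hx hy
      have hle : Submodule.span S {x | ∃ B ∈ 𝒟, ∃ C ∈ 𝒟, IsDiagram m S q P B C x} *
          Submodule.span S {x | ∃ B ∈ 𝒟, ∃ C ∈ 𝒟, IsDiagram m S q P B C x} ≤
          Submodule.span S {x | ∃ B ∈ 𝒟, ∃ C ∈ 𝒟, IsDiagram m S q P B C x} := by
        rw [Submodule.span_mul_span, Submodule.span_le]
        rintro _ ⟨a, ⟨B, hB, C, hC, ha⟩, b, ⟨B', hB', C', hC', hb⟩, rfl⟩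
        by_cases h : B = C'
        · subst h
          exact Submodule.subset_span ⟨B', hB', C, hC, IsDiagram.stack _ _ _ _ _ hb ha⟩
        · simp [hb.mul_eq_zero ha h]
      exact hle (Submodule.mul_mem_mul hx hy))

end Algebra

end TypeF

/-! ### The deformed parameters -/

namespace Deformed

/-- The power series ring `𝕜[[h, z_1, …, z_ℓ]]`; the variable `h` has index `none`, and `z_i` has
index `some i`. -/
abbrev Base (𝕜 : Type*) (ℓ : ℕ) : Type _ := MvPowerSeries (Option (Fin ℓ)) 𝕜

variable {𝕜 : Type*} [Field 𝕜] {ℓ : ℕ}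

/-- The deformed parameter `q d(h)`. -/
def qPar (ℓ : ℕ) (q : 𝕜) (d : PowerSeries 𝕜) : Base 𝕜 ℓ :=
  MvPowerSeries.C q * PowerSeries.subst (MvPowerSeries.X none : Base 𝕜 ℓ) d

/-- The deformed parameters `Q_i e^{-z_i}`. -/
def QPar [CharZero 𝕜] (Q : Fin ℓ → 𝕜) (i : Fin ℓ) : Base 𝕜 ℓ :=
  MvPowerSeries.C (Q i) *
    PowerSeries.subst (-MvPowerSeries.X (some i) : Base 𝕜 ℓ) (PowerSeries.exp 𝕜)

end Deformed

end

/-! ### Permutations with at most one inversion. -/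

open scoped Polynomial

noncomputable section

/-! Let e be the idempotent of B_0, the only member of 𝒟° with no point left of the red line. A
diagram absorbs the idempotents of its two ends, so in F every diagram with a violating end is zero,
and F_{𝒟°} is the corner eFe.

The isomorphism sends X_i to a square and T_r to ψ_r - e. Passing between the relations of T and
those of ψ is formal, except that T X T = q X' yields the square-crossing relations only after
cancelling the unit q. The cyclotomic relation is what the red line contributes: pulling the
leftmost strand across it and back passes through a violating configuration, hence gives zero, while
the bigon relation evaluates it to p(X_1)e (`aeval_sqE`).

Surjectivity: cut a diagram into slices. If some level is violating, the diagram vanishes. Otherwise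
no strand meets the red line, and every slice is a square or a matching with at most one green
crossing; crossing-free diagrams transport it to B_0 (`IsDiagram.exists_eq`).

Injectivity requires F to be large enough, and this is shown by a representation, without any basis
theorem. F acts on functions from configurations to the cyclotomic Hecke algebra: a slice acts as a
matrix unit from its bottom to its top, with entry 1, T_r + 1 or X_i^{±1}, and as zero if an end is
violating (`freeRep_rel`). Among the relations at the red line, only the bigon over a non-violating
configuration tests anything, and it asks exactly for p(X_1) = 0. An element a of the Hecke algebra
acts, through its image in the corner, as the matrix unit with entry a at (B_0, B_0) (`rep_val`), so
it can be read off. -/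

/-- A permutation of `Fin m` with at most one inversion is trivial or a simple transposition. -/
theorem Equiv.Perm.eq_one_or_eq_swap_of_inversions {m : ℕ} (π : Equiv.Perm (Fin m))
    (hπ : ∀ i j k l : Fin m, i < j → π j < π i → k < l → π l < π k → i = k ∧ j = l) :
    π = 1 ∨ ∃ (r : ℕ) (h : r + 1 < m), π = Equiv.swap ⟨r, Nat.lt_of_succ_lt h⟩ ⟨r + 1, h⟩ := by
  have mono_eq_one : ∀ ρ : Equiv.Perm (Fin m), StrictMono ρ → ρ = 1 := by
    intro ρ hρ
    have : hρ.orderIsoOfSurjective _ ρ.surjective = OrderIso.refl (Fin m) := Subsingleton.elim _ _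
    ext i
    exact congrArg Fin.val (DFunLike.congr_fun this i)
  by_cases hmono : StrictMono π
  · exact Or.inl (mono_eq_one π hmono)
  · right
    have hdesc : ∃ (r : ℕ) (h : r + 1 < m), π ⟨r + 1, h⟩ < π ⟨r, Nat.lt_of_succ_lt h⟩ := by
      by_contra! hasc
      apply hmono
      cases m with
      | zero => exact fun i => i.elim0
      | succ n =>
        rw [Fin.strictMono_iff_lt_succ]
        intro i
        refine lt_of_le_of_ne (hasc i (by omega)) fun h => ?_
        exact (Fin.castSucc_lt_succ (i := i)).ne (π.injective h)
    obtain ⟨r, h, hr⟩ := hdesc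
    refine ⟨r, h, ?_⟩
    set a : Fin m := ⟨r, Nat.lt_of_succ_lt h⟩ with ha
    set b : Fin m := ⟨r + 1, h⟩ with hb
    have hab : a < b := by simp [ha, hb]
    -- Undoing the adjacent descent leaves no inversion: one whose order survives the swap would be
    -- a second inversion of π, and the only pair whose order is reversed is (a, b) itself, where
    -- the descent has been undone.
    have key : π * Equiv.swap a b = 1 := by
      apply mono_eq_one
      intro i j hij
      by_contra hlt
      have hlt' : π (Equiv.swap a b j) < π (Equiv.swap a b i) := by
        refine lt_of_le_of_ne (not_lt.mp hlt) fun h => hij.ne ?_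
        exact ((Equiv.swap a b).injective (π.injective h)).symm
      rcases lt_trichotomy (Equiv.swap a b i) (Equiv.swap a b j) with h1 | h1 | h1
      · obtain ⟨h2, h3⟩ := hπ _ _ _ _ h1 hlt' hab hr
        rw [Equiv.swap_apply_eq_iff, Equiv.swap_apply_left] at h2
        rw [Equiv.swap_apply_eq_iff, Equiv.swap_apply_right] at h3
        subst h2 h3
        exact absurd hij hab.not_gt
      · exact hij.ne ((Equiv.swap a b).injective h1)
      · have hi : i = a ∧ j = b := by
          simp only [Equiv.swap_apply_def] at h1
          grind
        rw [hi.1, hi.2, Equiv.swap_apply_left, Equiv.swap_apply_right] at hlt'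
        exact absurd hlt' hr.not_gt
    rw [mul_eq_one_iff_eq_inv, Equiv.swap_inv] at key
    exact key

/-! ### Matchings as permutations, and configurations right of the red line. -/

namespace TypeF

variable {m : ℕ}

/-- All green strands are to the right of the red line. -/
def Config.IsPos (B : Config m) : Prop := ∀ b ∈ B.pts, 0 < b

theorem Config.not_isPos {B : Config m} : ¬ B.IsPos ↔ ∃ b ∈ B.pts, b < 0 := by
  unfold Config.IsPos
  push Not
  refine exists_congr fun b => and_congr_right fun hb => ?_
  have : b ≠ 0 := fun h => B.zero_notMem (h ▸ hb)
  exact ⟨fun h => lt_of_le_of_ne h this, le_of_lt⟩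

theorem Config.isPos_iff_numLeft {B : Config m} : B.IsPos ↔ B.numLeft = 0 := by
  rw [← not_iff_not, Config.not_isPos, Config.numLeft, Finset.card_eq_zero,
    Finset.filter_eq_empty_iff]
  push Not
  rfl

/-- The points of a configuration, numbered from the left. -/
def Config.pt (B : Config m) : Fin m ≃o B.pts := B.pts.orderIsoOfFin B.card_pts

/-- The permutation of the numbers of the strands which is induced by a matching. -/
def perm {B C : Config m} (σ : B.pts ≃ C.pts) : Equiv.Perm (Fin m) :=
  B.pt.toEquiv.trans (σ.trans C.pt.symm.toEquiv)

/-- The matching which induces a given permutation of the numbers of the strands. -/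
def ofPerm (B C : Config m) (π : Equiv.Perm (Fin m)) : B.pts ≃ C.pts :=
  B.pt.symm.toEquiv.trans (π.trans C.pt.toEquiv)

section

variable {B C D : Config m}

theorem pt_perm (σ : B.pts ≃ C.pts) (i : Fin m) : C.pt (perm σ i) = σ (B.pt i) := by
  simp [perm]

@[simp] theorem perm_ofPerm (π : Equiv.Perm (Fin m)) : perm (ofPerm B C π) = π := by
  ext i; simp [perm, ofPerm]

@[simp] theorem ofPerm_perm (σ : B.pts ≃ C.pts) : ofPerm B C (perm σ) = σ := by
  ext i; simp [perm, ofPerm]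

theorem perm_injective : Function.Injective (perm : (B.pts ≃ C.pts) → _) :=
  Function.LeftInverse.injective (g := ofPerm B C) ofPerm_perm

@[simp] theorem perm_refl : perm (Equiv.refl B.pts) = 1 := by
  ext i; simp [perm]

@[simp] theorem perm_trans (σ : B.pts ≃ C.pts) (τ : C.pts ≃ D.pts) :
    perm (σ.trans τ) = perm τ * perm σ := by
  ext i; simp [perm]

@[simp] theorem perm_swap (a b : B.pts) :
    perm (Equiv.swap a b) = Equiv.swap (B.pt.symm a) (B.pt.symm b) := by
  ext i
  have : B.pt (perm (Equiv.swap a b) i) = B.pt (Equiv.swap (B.pt.symm a) (B.pt.symm b) i) := by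
    rw [pt_perm, Equiv.swap_apply_def, Equiv.swap_apply_def, apply_ite B.pt, apply_ite B.pt]
    simp [OrderIso.eq_symm_apply]
  exact congrArg Fin.val (B.pt.injective this)

theorem mem_crossings_green (σ : B.pts ≃ C.pts) (i j : Fin m) :
    s(some (B.pt i), some (B.pt j)) ∈ crossings σ ↔
      (i < j ∧ perm σ j < perm σ i) ∨ (j < i ∧ perm σ i < perm σ j) := by
  rw [mk_mem_crossings]
  have h1 : ∀ k l : Fin m, ((B.pt k : B.pts) : ℝ) < B.pt l ↔ k < l := fun k l => by
    rw [Subtype.coe_lt_coe, OrderIso.lt_iff_lt]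
  have h2 : ∀ k l : Fin m, ((σ (B.pt k) : C.pts) : ℝ) < σ (B.pt l) ↔ perm σ k < perm σ l :=
    fun k l => by rw [← pt_perm, ← pt_perm, Subtype.coe_lt_coe, OrderIso.lt_iff_lt]
  simp only [extend, Config.pos, Equiv.optionCongr_apply, Option.map_some]
  rw [mul_neg_iff, sub_pos, sub_neg, sub_pos, sub_neg, h1, h1, h2, h2]
  tauto

theorem mem_crossings_red (σ : B.pts ≃ C.pts) (a : B.pts) :
    s(none, some a) ∈ crossings σ ↔ (a : ℝ) * (σ a : ℝ) < 0 := by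
  rw [mk_mem_crossings]
  simp [extend, Config.pos]

theorem not_mem_crossings_self (σ : B.pts ≃ C.pts) (x : B.Strand) : s(x, x) ∉ crossings σ := by
  rw [mk_mem_crossings]; simp

theorem perm_eq_one_of_crossings_eq_empty {σ : B.pts ≃ C.pts} (h : crossings σ = ∅) :
    perm σ = 1 := by
  rcases (perm σ).eq_one_or_eq_swap_of_inversions (fun i j _ _ h1 h2 _ _ => absurd
    ((mem_crossings_green σ i j).mpr (Or.inl ⟨h1, h2⟩)) (by simp [h])) with h1 | ⟨r, hr, h1⟩
  · exact h1
  · exact absurd ((mem_crossings_green σ ⟨r, Nat.lt_of_succ_lt hr⟩ ⟨r + 1, hr⟩).mpr (Or.inl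
      ⟨by simp, by rw [h1, Equiv.swap_apply_left, Equiv.swap_apply_right]; simp⟩)) (by simp [h])

/-- Inversions of `perm σ` are the green crossings of σ, and crossings with the red line leave no
trace in `perm σ`; so a single crossing allows at most one inversion. -/
theorem perm_cases {σ : B.pts ≃ C.pts} (h : (crossings σ).Subsingleton) :
    perm σ = 1 ∨ ∃ (r : ℕ) (h : r + 1 < m),
      perm σ = Equiv.swap ⟨r, Nat.lt_of_succ_lt h⟩ ⟨r + 1, h⟩ := by
  refine (perm σ).eq_one_or_eq_swap_of_inversions fun i j k l h1 h2 h3 h4 => ?_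
  have := h ((mem_crossings_green σ i j).mpr (Or.inl ⟨h1, h2⟩))
    ((mem_crossings_green σ k l).mpr (Or.inl ⟨h3, h4⟩))
  simp only [Sym2.eq_iff, Option.some_inj, EmbeddingLike.apply_eq_iff_eq] at this
  rcases this with h | ⟨rfl, rfl⟩
  · exact h
  · exact absurd h1 h3.not_gt

theorem swap_mem_crossings {σ : B.pts ≃ C.pts} {r : ℕ} {hr : r + 1 < m}
    (h : perm σ = Equiv.swap ⟨r, Nat.lt_of_succ_lt hr⟩ ⟨r + 1, hr⟩) :
    s(some (B.pt ⟨r, Nat.lt_of_succ_lt hr⟩), some (B.pt ⟨r + 1, hr⟩)) ∈ crossings σ := by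
  rw [mem_crossings_green, h, Equiv.swap_apply_left, Equiv.swap_apply_right]
  simp

/-- A green strand of a matching between configurations to the right of the red line does not
cross the red line. -/
theorem red_not_mem_crossings (hB : B.IsPos) (hC : C.IsPos) (σ : B.pts ≃ C.pts) (a : B.pts) :
    s(none, some a) ∉ crossings σ := by
  rw [mem_crossings_red, not_lt]
  exact (mul_pos (hB _ a.2) (hC _ (σ a).2)).le

theorem exists_of_mem_crossings (hB : B.IsPos) (hC : C.IsPos) {σ : B.pts ≃ C.pts}
    {u : Sym2 B.Strand} (hu : u ∈ crossings σ) :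
    ∃ i j : Fin m, i < j ∧ perm σ j < perm σ i ∧ u = s(some (B.pt i), some (B.pt j)) := by
  induction u using Sym2.ind with
  | _ x y =>
    match x, y with
    | none, none => exact absurd hu (not_mem_crossings_self σ none)
    | none, some a => exact absurd hu (red_not_mem_crossings hB hC σ a)
    | some a, none => exact absurd (Sym2.eq_swap ▸ hu) (red_not_mem_crossings hB hC σ a)
    | some a, some b =>
      obtain ⟨i, rfl⟩ := B.pt.surjective a
      obtain ⟨j, rfl⟩ := B.pt.surjective b
      rcases (mem_crossings_green σ i j).mp hu with h | h
      · exact ⟨i, j, h.1, h.2, rfl⟩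
      · exact ⟨j, i, h.1, h.2, Sym2.eq_swap⟩

theorem crossings_eq_empty (hB : B.IsPos) (hC : C.IsPos) {σ : B.pts ≃ C.pts} (h : perm σ = 1) :
    crossings σ = ∅ := by
  rw [Set.eq_empty_iff_forall_notMem]
  intro u hu
  obtain ⟨i, j, h1, h2, -⟩ := exists_of_mem_crossings hB hC hu
  rw [h] at h2
  exact absurd h1 h2.not_gt

/-- Between configurations right of the red line all crossings are green, hence inversions, and a
simple transposition has only one. -/
theorem crossings_eq_singleton (hB : B.IsPos) (hC : C.IsPos) {σ : B.pts ≃ C.pts} {r : ℕ}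
    {hr : r + 1 < m} (h : perm σ = Equiv.swap ⟨r, Nat.lt_of_succ_lt hr⟩ ⟨r + 1, hr⟩) :
    crossings σ = {s(some (B.pt ⟨r, Nat.lt_of_succ_lt hr⟩), some (B.pt ⟨r + 1, hr⟩))} := by
  refine Set.eq_singleton_iff_unique_mem.mpr ⟨swap_mem_crossings h, fun u hu => ?_⟩
  obtain ⟨i, j, h1, h2, rfl⟩ := exists_of_mem_crossings hB hC hu
  have : i = ⟨r, Nat.lt_of_succ_lt hr⟩ ∧ j = ⟨r + 1, hr⟩ := by
    rw [h] at h2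
    simp only [Equiv.swap_apply_def] at h2
    grind
  rw [this.1, this.2]

theorem crossings_subsingleton (hB : B.IsPos) (hC : C.IsPos) {σ : B.pts ≃ C.pts}
    (h : perm σ = 1 ∨ ∃ (r : ℕ) (h : r + 1 < m),
      perm σ = Equiv.swap ⟨r, Nat.lt_of_succ_lt h⟩ ⟨r + 1, h⟩) :
    (crossings σ).Subsingleton := by
  rcases h with h | ⟨r, hr, h⟩
  · rw [crossings_eq_empty hB hC h]; exact Set.subsingleton_empty
  · rw [crossings_eq_singleton hB hC h]; exact Set.subsingleton_singleton

/-- Neighbouring strands have consecutive numbers. -/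
theorem exists_eq_pt_of_swap {a b : B.pts} (hab : a < b)
    (h : (crossings (Equiv.swap a b)).Subsingleton) :
    ∃ (r : ℕ) (hr : r + 1 < m), a = B.pt ⟨r, Nat.lt_of_succ_lt hr⟩ ∧ b = B.pt ⟨r + 1, hr⟩ := by
  obtain ⟨i, rfl⟩ := B.pt.surjective a
  obtain ⟨j, rfl⟩ := B.pt.surjective b
  rw [OrderIso.lt_iff_lt] at hab
  rcases perm_cases h with h | ⟨r, hr, h⟩
  · simp only [perm_swap, OrderIso.symm_apply_apply, Equiv.swap_eq_one_iff] at h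
    exact absurd h hab.ne
  · simp only [perm_swap, OrderIso.symm_apply_apply] at h
    refine ⟨r, hr, ?_⟩
    have hi : Equiv.swap ⟨r, Nat.lt_of_succ_lt hr⟩ ⟨r + 1, hr⟩ i = j := by
      rw [← h, Equiv.swap_apply_left]
    rw [Equiv.swap_apply_def] at hi
    simp only [EmbeddingLike.apply_eq_iff_eq]
    split_ifs at hi with h1 h2
    · exact ⟨h1, hi.symm⟩
    · subst h2 hi; simp [Fin.lt_def] at hab
    · exact absurd hi hab.ne

/-- If the strand at `a` is the only one to cross the red line, and `B` is on the right of it,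
then this strand is the leftmost one. -/
theorem pt_symm_eq_zero (hB : B.IsPos) {σ : B.pts ≃ C.pts} {a : B.pts}
    (h : crossings σ = {s(none, some a)}) : ((B.pt.symm a : Fin m) : ℕ) = 0 := by
  by_contra hne
  obtain ⟨i, rfl⟩ := B.pt.surjective a
  rw [OrderIso.symm_apply_apply] at hne
  have hm : 0 < m := i.pos
  set z : Fin m := ⟨0, hm⟩
  have hz : z < i := by simp [z, Fin.lt_def]; omega
  have hzi : B.pt z < B.pt i := B.pt.lt_iff_lt.mpr hz
  have hi := (mem_crossings_red σ (B.pt i)).mp (by simp [h])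
  have hz' : ¬ (B.pt z : ℝ) * (σ (B.pt z) : ℝ) < 0 := by
    rw [← mem_crossings_red, h]
    simp [hz.ne]
  have hpi := hB _ (B.pt i).2
  have hpz := hB _ (B.pt z).2
  have h1 : (σ (B.pt i) : ℝ) < 0 := by
    by_contra hc; exact absurd hi (mul_nonneg hpi.le (not_lt.mp hc)).not_gt
  have h2 : 0 ≤ (σ (B.pt z) : ℝ) := by
    by_contra hc; exact hz' (mul_neg_of_pos_of_neg hpz (not_le.mp hc))
  -- Strand i ends left of the red line while z, which started to its left, stays on the right; so
  -- the two cross, and this would be a second crossing.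
  have : s(some (B.pt z), some (B.pt i)) ∈ crossings σ := by
    rw [mem_crossings_green]
    refine Or.inl ⟨hz, ?_⟩
    rw [← C.pt.lt_iff_lt, pt_perm, pt_perm, ← Subtype.coe_lt_coe]
    linarith
  rw [h] at this
  simp at this

/-- If no strand of a matching crosses the red line, then both ends are on the same side. -/
theorem isPos_of_red_not_mem (hB : B.IsPos) {σ : B.pts ≃ C.pts}
    (h : ∀ a, s(none, some a) ∉ crossings σ) : C.IsPos := by
  intro c hc
  have := h (σ.symm ⟨c, hc⟩)
  rw [mem_crossings_red, Equiv.apply_symm_apply, not_lt] at this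
  have h0 := hB _ (σ.symm ⟨c, hc⟩).2
  refine lt_of_le_of_ne (nonneg_of_mul_nonneg_right this h0) fun hc0 => C.zero_notMem (hc0 ▸ hc)

theorem isPos_of_red_not_mem' (hC : C.IsPos) {σ : B.pts ≃ C.pts}
    (h : ∀ a, s(none, some a) ∉ crossings σ) : B.IsPos := by
  intro b hb
  have := h ⟨b, hb⟩
  rw [mem_crossings_red, not_lt] at this
  have h0 := hC _ (σ ⟨b, hb⟩).2
  refine lt_of_le_of_ne (nonneg_of_mul_nonneg_left this h0) fun hc0 => B.zero_notMem (hc0 ▸ hb)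

end

end TypeF

/-! ### The Hecke relations in terms of the crossings ψ = T + 1. -/

namespace Hecke

section HeckePair

variable {S A : Type*} [CommRing S] [Ring A] [Algebra S A] {q : S}

/-- With ψ = T + 1 the quadratic relation (T + 1)(T - q) = 0 reads ψ(ψ - (1 + q)) = 0. In this
section the lemmas named with `add_one` pass from T to ψ, those with `sub_one` from ψ back to T. -/
theorem add_one_mul_add_one {t : A} (ht : t * t = (q - 1) • t + algebraMap S A q) :
    (t + 1) * (t + 1) = (1 + q) • (t + 1) := by
  rw [add_mul, mul_add, ht, Algebra.algebraMap_eq_smul_one]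
  simp only [one_mul, mul_one]
  module

theorem sub_one_mul_sub_one {p : A} (hp : p * p = (1 + q) • p) :
    (p - 1) * (p - 1) = (q - 1) • (p - 1) + algebraMap S A q := by
  rw [sub_mul, mul_sub, hp, Algebra.algebraMap_eq_smul_one]
  simp only [one_mul, mul_one]
  module

theorem braid_add_one {t u : A} (ht : t * t = (q - 1) • t + algebraMap S A q)
    (hu : u * u = (q - 1) • u + algebraMap S A q) (h : t * u * t = u * t * u) :
    (t + 1) * (u + 1) * (t + 1) - (u + 1) * (t + 1) * (u + 1) = q • (t + 1) - q • (u + 1) := by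
  have e1 : (t + 1) * (u + 1) * (t + 1) - (u + 1) * (t + 1) * (u + 1)
      = t * u * t - u * t * u + (t * t + t) - (u * u + u) := by noncomm_ring
  rw [e1, h, ht, hu]
  module

theorem braid_sub_one {t u : A} (ht : t * t = (1 + q) • t) (hu : u * u = (1 + q) • u)
    (h : t * u * t - u * t * u = q • t - q • u) :
    (t - 1) * (u - 1) * (t - 1) = (u - 1) * (t - 1) * (u - 1) := by
  have e1 : (t - 1) * (u - 1) * (t - 1)
      = (u - 1) * (t - 1) * (u - 1) + (t * u * t - u * t * u) - t * t + u * u + t - u := by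
    noncomm_ring
  rw [e1, h, ht, hu]
  module

/-- Multiplying t x t = q y by t on the left and expanding t² expresses q(x t) through t y and y;
cancelling q moves x past t. The next lemma is the mirror image, multiplying on the right. -/
theorem mul_add_one_sub (hq : IsUnit q) {t x y : A}
    (ht : t * t = (q - 1) • t + algebraMap S A q) (h : t * x * t = q • y) :
    x * (t + 1) - (t + 1) * y = x - q • y := by
  have h1 : q • (x * t) = q • (t * y - (q - 1) • y) := by
    have h2 : t * (t * x * t) = (q - 1) • (t * x * t) + q • (x * t) := by
      rw [← mul_assoc, ← mul_assoc, ht, Algebra.algebraMap_eq_smul_one]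
      simp only [add_mul, smul_mul_assoc, one_mul, mul_assoc]
    rw [h, mul_smul_comm] at h2
    rw [smul_sub, h2]
    module
  have h3 : x * t = t * y - (q - 1) • y := hq.smul_left_cancel.mp h1
  rw [mul_add, h3, add_mul, mul_one, one_mul]
  module

theorem add_one_mul_sub (hq : IsUnit q) {t x y : A}
    (ht : t * t = (q - 1) • t + algebraMap S A q) (h : t * x * t = q • y) :
    (t + 1) * x - y * (t + 1) = x - q • y := by
  have h1 : q • (t * x) = q • (y * t - (q - 1) • y) := by
    have h2 : t * x * t * t = (q - 1) • (t * x * t) + q • (t * x) := by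
      rw [mul_assoc, ht, Algebra.algebraMap_eq_smul_one]
      simp only [mul_add, mul_smul_comm, mul_one]
    rw [h, smul_mul_assoc] at h2
    rw [smul_sub, h2]
    module
  have h3 : t * x = y * t - (q - 1) • y := hq.smul_left_cancel.mp h1
  rw [add_mul, h3, mul_add, mul_one, one_mul]
  module

/-- Only one of the two square-crossing relations is needed in this direction, and q need not be
invertible. -/
theorem sub_one_mul_mul_sub_one {p x y : A} (hp : p * p = (1 + q) • p)
    (h : x * p - p * y = x - q • y) : (p - 1) * x * (p - 1) = q • y := by
  have e1 : (p - 1) * x * (p - 1) = p * (x * p - p * y) - (x * p - p * y) + p * p * y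
      - p * y - p * x + x := by noncomm_ring
  rw [e1, h, hp, mul_sub, mul_smul_comm, smul_mul_assoc]
  module

end HeckePair

section Generators

variable {S A : Type*} [CommRing S] [Ring A] [Algebra S A] {q : S} {m ℓ : ℕ} {P : Fin ℓ → S}

/-- The image of the generator `X_i` (`pos = true`) or of its inverse. -/
def x (f : FreeAlgebra S (Gen m) →ₐ[S] A) (i : Fin m) (pos : Bool) : A :=
  f (gen S (if pos then Gen.X i else Gen.Xinv i))

/-- The image of the generator `T_r`. -/
def t (f : FreeAlgebra S (Gen m) →ₐ[S] A) (r : ℕ) (h : r + 1 < m) : A := f (gen S (Gen.T r h))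

open Classical in
/-- The element attached to a permutation: `1` for the trivial one, and `T_r + 1` for the `r`th
simple transposition. -/
def psi (f : FreeAlgebra S (Gen m) →ₐ[S] A) (π : Equiv.Perm (Fin m)) : A :=
  if h : ∃ (r : ℕ) (h : r + 1 < m), π = Equiv.swap ⟨r, Nat.lt_of_succ_lt h⟩ ⟨r + 1, h⟩
  then t f h.choose h.choose_spec.choose + 1 else 1

theorem psi_one (f : FreeAlgebra S (Gen m) →ₐ[S] A) : psi f 1 = 1 := by
  rw [psi, dif_neg]
  rintro ⟨r, h, h1⟩
  have := (Equiv.swap_eq_one_iff.mp h1.symm)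
  simp at this

theorem psi_swap (f : FreeAlgebra S (Gen m) →ₐ[S] A) (r : ℕ) (h : r + 1 < m) :
    psi f (Equiv.swap ⟨r, Nat.lt_of_succ_lt h⟩ ⟨r + 1, h⟩) = t f r h + 1 := by
  have hex : ∃ (s : ℕ) (h' : s + 1 < m),
      (Equiv.swap ⟨r, Nat.lt_of_succ_lt h⟩ ⟨r + 1, h⟩ : Equiv.Perm (Fin m))
        = Equiv.swap ⟨s, Nat.lt_of_succ_lt h'⟩ ⟨s + 1, h'⟩ := ⟨r, h, rfl⟩
  -- `psi` uses a chosen index; the image of r under the transposition shows that it can only be r.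
  have : r = hex.choose := by
    have h2 := congrArg (fun π => π ⟨r, Nat.lt_of_succ_lt h⟩) hex.choose_spec.choose_spec
    simp only [Equiv.swap_apply_left, Equiv.swap_apply_def, Fin.ext_iff] at h2
    split_ifs at h2 <;> simp only at h2 <;> omega
  rw [psi, dif_pos hex]
  congr 2
  exact this.symm

variable (q P) in
/-- The homomorphism from the free algebra respects the relations of the cyclotomic Hecke
algebra. -/
structure IsCyclotomic (f : FreeAlgebra S (Gen m) →ₐ[S] A) : Prop where
  rel : ∀ ⦃a b⦄, Rel S q m a b → f a = f b
  cyc : ∀ h : 0 < m, Polynomial.aeval (x f ⟨0, h⟩ true) (cycPoly P) = 0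

namespace IsCyclotomic

variable {f : FreeAlgebra S (Gen m) →ₐ[S] A}

theorem x_mul_x_not (hf : IsCyclotomic q P f) (i : Fin m) (p : Bool) : x f i p * x f i (!p) = 1 := by
  unfold x
  rw [← map_mul, ← map_one f]
  cases p
  · exact hf.rel (Rel.Xinv_mul_X i)
  · exact hf.rel (Rel.X_mul_Xinv i)

theorem x_comm (hf : IsCyclotomic q P f) (i j : Fin m) (p p' : Bool) : x f i p * x f j p' = x f j p' * x f i p := by
  unfold x
  rw [← map_mul, ← map_mul]
  cases p <;> cases p'
  · exact hf.rel (Rel.Xinv_Xinv i j)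
  · exact (hf.rel (Rel.X_Xinv j i)).symm
  · exact hf.rel (Rel.X_Xinv i j)
  · exact hf.rel (Rel.X_X i j)

theorem t_mul_self (hf : IsCyclotomic q P f) (r : ℕ) (h : r + 1 < m) :
    t f r h * t f r h = (q - 1) • t f r h + algebraMap S A q := by
  simpa [t] using hf.rel (Rel.T_sq r h)

theorem t_x_t (hf : IsCyclotomic q P f) (r : ℕ) (h : r + 1 < m) :
    t f r h * x f ⟨r, Nat.lt_of_succ_lt h⟩ true * t f r h = q • x f ⟨r + 1, h⟩ true := by
  simpa [t, x] using hf.rel (Rel.T_X_T r h)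

theorem t_braid (hf : IsCyclotomic q P f) (r : ℕ) (h : r + 1 < m) (h' : r + 1 + 1 < m) :
    t f r h * t f (r + 1) h' * t f r h = t f (r + 1) h' * t f r h * t f (r + 1) h' := by
  simpa [t] using hf.rel (Rel.braid r h h')

theorem t_comm (hf : IsCyclotomic q P f) (r s : ℕ) (h : r + 1 < m) (h' : s + 1 < m) (h₁ : r ≠ s + 1) (h₂ : s ≠ r + 1) :
    t f r h * t f s h' = t f s h' * t f r h := by
  simpa [t] using hf.rel (Rel.T_T r s h h' h₁ h₂)

theorem t_mul_x (hf : IsCyclotomic q P f) (r : ℕ) (h : r + 1 < m) (s : Fin m) (h₁ : (s : ℕ) ≠ r) (h₂ : (s : ℕ) ≠ r + 1)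
    (p : Bool) : t f r h * x f s p = x f s p * t f r h := by
  have hx : t f r h * x f s true = x f s true * t f r h := by
    simpa [t, x] using hf.rel (Rel.T_X r h s h₁ h₂)
  cases p
  · let u : Aˣ := ⟨x f s true, x f s false, hf.x_mul_x_not s true, hf.x_mul_x_not s false⟩
    exact Commute.units_inv_right (u := u) hx
  · exact hx

end IsCyclotomic

/-- Squares and crossings which satisfy the local relations define a homomorphism which respects
the relations of the cyclotomic Hecke algebra. -/
theorem exists_isCyclotomic (xs : Fin m → Bool → A) (ps : ∀ r, r + 1 < m → A)
    (h_inv : ∀ i b, xs i b * xs i (!b) = 1)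
    (h_comm : ∀ i j b b', xs i b * xs j b' = xs j b' * xs i b)
    (h_sq : ∀ r h, ps r h * ps r h = (1 + q) • ps r h)
    (h_x : ∀ r h, xs ⟨r, Nat.lt_of_succ_lt h⟩ true * ps r h - ps r h * xs ⟨r + 1, h⟩ true
      = xs ⟨r, Nat.lt_of_succ_lt h⟩ true - q • xs ⟨r + 1, h⟩ true)
    (h_braid : ∀ r h h', ps r h * ps (r + 1) h' * ps r h - ps (r + 1) h' * ps r h * ps (r + 1) h'
      = q • ps r h - q • ps (r + 1) h')
    (h_px : ∀ r h (s : Fin m), (s : ℕ) ≠ r → (s : ℕ) ≠ r + 1 →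
      ps r h * xs s true = xs s true * ps r h)
    (h_pp : ∀ r s h h', r ≠ s → r ≠ s + 1 → s ≠ r + 1 → ps r h * ps s h' = ps s h' * ps r h)
    (h_cyc : ∀ h : 0 < m, Polynomial.aeval (xs ⟨0, h⟩ true) (cycPoly P) = 0) :
    ∃ f : FreeAlgebra S (Gen m) →ₐ[S] A, IsCyclotomic q P f ∧
      (∀ i b, x f i b = xs i b) ∧ ∀ r h, t f r h = ps r h - 1 := by
  let f : FreeAlgebra S (Gen m) →ₐ[S] A := FreeAlgebra.lift S fun g => match g with
    | Gen.X i => xs i true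
    | Gen.Xinv i => xs i false
    | Gen.T r h => ps r h - 1
  have fX : ∀ i, f (gen S (Gen.X i)) = xs i true := fun i => FreeAlgebra.lift_ι_apply _ _
  have fXinv : ∀ i, f (gen S (Gen.Xinv i)) = xs i false := fun i => FreeAlgebra.lift_ι_apply _ _
  have fT : ∀ r h, f (gen S (Gen.T r h)) = ps r h - 1 := fun r h => FreeAlgebra.lift_ι_apply _ _
  refine ⟨f, ⟨fun a b hab => ?_, fun h => ?_⟩, fun i b => ?_, fT⟩
  · induction hab with
    | X_mul_Xinv i => simpa [fX, fXinv] using h_inv i true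
    | Xinv_mul_X i => simpa [fX, fXinv] using h_inv i false
    | X_X i j => simpa [fX] using h_comm i j true true
    | X_Xinv i j => simpa [fX, fXinv] using h_comm i j true false
    | Xinv_Xinv i j => simpa [fXinv] using h_comm i j false false
    | T_sq r h =>
      rw [map_mul, map_add, map_smul, AlgHom.commutes, fT, sub_one_mul_sub_one (h_sq r h)]
    | T_X_T r h =>
      rw [map_mul, map_mul, map_smul, fT, fX, fX, sub_one_mul_mul_sub_one (h_sq r h) (h_x r h)]
    | braid r h h' =>
      simp only [map_mul, fT]
      exact braid_sub_one (h_sq r h) (h_sq (r + 1) h') (h_braid r h h')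
    | T_X r h s h₁ h₂ =>
      simp only [map_mul, fT, fX, sub_mul, mul_sub, one_mul, mul_one, h_px r h s h₁ h₂]
    | T_T r s h h' h₁ h₂ =>
      simp only [map_mul, fT]
      -- The Hecke relation includes the trivial case r = s, where no diagram relation is available
      -- or needed.
      by_cases hrs : r = s
      · subst hrs; rfl
      · simp only [sub_mul, mul_sub, one_mul, mul_one, h_pp r s h h' hrs h₁ h₂]
        abel
  · rw [x, if_pos rfl, fX]; exact h_cyc h
  · cases b
    · exact fXinv i
    · exact fX i

end Generators

section Cyclotomic

variable {S : Type*} [CommRing S] {q : S} {m ℓ : ℕ} {P : Fin ℓ → S}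

variable (S q m P) in
/-- The projection from the free algebra to the cyclotomic Hecke algebra. -/
def Cyclotomic.mk : FreeAlgebra S (Gen m) →ₐ[S] Cyclotomic S q m P :=
  (RingQuot.mkAlgHom S (CycRel S q m P)).comp (RingQuot.mkAlgHom S (Rel S q m))

theorem Cyclotomic.mk_surjective : Function.Surjective (Cyclotomic.mk S q m P) :=
  (RingQuot.mkAlgHom_surjective S _).comp (RingQuot.mkAlgHom_surjective S _)

theorem Cyclotomic.isCyclotomic_mk : IsCyclotomic (A := Cyclotomic S q m P) q P (Cyclotomic.mk S q m P) where
  rel a b h := by simp only [Cyclotomic.mk, AlgHom.comp_apply, RingQuot.mkAlgHom_rel S h]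
  cyc h := by
    have := RingQuot.mkAlgHom_rel S (CycRel.cyc (S := S) (q := q) (m := m) (P := P) h)
    rw [← Polynomial.aeval_algHom_apply, map_zero] at this
    exact this

/-- The universal property of the cyclotomic Hecke algebra. -/
theorem IsCyclotomic.exists_lift {A : Type*} [Ring A] [Algebra S A]
    {f : FreeAlgebra S (Gen m) →ₐ[S] A} (hf : IsCyclotomic q P f) :
    ∃ g : Cyclotomic S q m P →ₐ[S] A, ∀ a, g (Cyclotomic.mk S q m P a) = f a := by
  refine ⟨RingQuot.liftAlgHom S ⟨RingQuot.liftAlgHom S ⟨f, hf.rel⟩, ?_⟩, fun a => ?_⟩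
  · rintro _ _ ⟨h⟩
    rw [map_zero, ← Polynomial.aeval_algHom_apply, Affine.X, RingQuot.liftAlgHom_mkAlgHom_apply]
    exact hf.cyc h
  · rw [Cyclotomic.mk, AlgHom.comp_apply, RingQuot.liftAlgHom_mkAlgHom_apply,
      RingQuot.liftAlgHom_mkAlgHom_apply]

end Cyclotomic

end Hecke

/-! ### Matrix units. -/

/-- The endomorphism of the free module `ι → A` whose matrix has the entry `a` in row `i` and
column `j` and `0` elsewhere. -/
def matrixUnit (S : Type*) {ι A : Type*} [CommRing S] [Ring A] [Algebra S A] (i j : ι) (a : A) :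
    Module.End S (ι → A) :=
  open Classical in
  (LinearMap.single S (fun _ => A) i).comp ((LinearMap.mulLeft S a).comp (LinearMap.proj j))

namespace matrixUnit

variable {S ι A : Type*} [CommRing S] [Ring A] [Algebra S A] (i j k l : ι) (a b : A)

open Classical in
theorem apply (f : ι → A) : matrixUnit S i j a f = Pi.single i (a * f j) := rfl

theorem mul : matrixUnit S i j a * matrixUnit S j k b = matrixUnit S i k (a * b) := by
  classical
  ext1 f
  simp only [Module.End.mul_apply, apply, Pi.single_eq_same, mul_assoc]

theorem mul_of_ne {j k : ι} (h : j ≠ k) : matrixUnit S i j a * matrixUnit S k l b = 0 := by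
  classical
  ext1 f
  simp [Module.End.mul_apply, apply, h]

theorem zero : matrixUnit S i j (0 : A) = 0 := by
  classical
  ext1 f
  simp [apply]

theorem add : matrixUnit S i j (a + b) = matrixUnit S i j a + matrixUnit S i j b := by
  classical
  ext1 f
  simp [apply, add_mul, Pi.single_add]

theorem sub : matrixUnit S i j (a - b) = matrixUnit S i j a - matrixUnit S i j b := by
  classical
  ext1 f
  simp [apply, sub_mul, Pi.single_sub]

theorem smul (c : S) : matrixUnit S i j (c • a) = c • matrixUnit S i j a := by
  classical
  ext1 f
  simp [apply, Pi.single_smul]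

theorem injective : Function.Injective (matrixUnit S i j : A → Module.End S (ι → A)) := by
  classical
  intro a b h
  -- The entry is recovered by applying the matrix unit to the basis vector at j and reading
  -- coordinate i; this uses the unit of A.
  simpa [apply] using congrFun (LinearMap.congr_fun h (Pi.single j 1)) i

/-- The factor E_ii(1) matters for n = 0, where the power is the identity of the whole module rather
than of the i-th summand. Constant terms of polynomials are treated the same way below. -/
theorem pow_mul_one (n : ℕ) :
    matrixUnit S i i a ^ n * matrixUnit S i i 1 = matrixUnit S i i (a ^ n) := by
  induction n with
  | zero => simp
  | succ n ih => rw [pow_succ', mul_assoc, ih, mul, pow_succ']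

theorem aeval_mul_one (p : S[X]) :
    Polynomial.aeval (matrixUnit S i i a) p * matrixUnit S i i 1
      = matrixUnit S i i (Polynomial.aeval a p) := by
  induction p using Polynomial.induction_on' with
  | add p p' h h' => rw [map_add, map_add, add_mul, h, h', add]
  | monomial n c =>
    rw [Polynomial.aeval_monomial, Polynomial.aeval_monomial, ← Algebra.smul_def,
      ← Algebra.smul_def, smul_mul_assoc, pow_mul_one, smul]

end matrixUnit

/-! ### The representation of F over the cyclotomic Hecke algebra. -/

namespace TypeF

open Hecke

section Rep

variable {S A : Type*} [CommRing S] [Ring A] [Algebra S A] {q : S} {m ℓ : ℕ} {P : Fin ℓ → S}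
variable (f : FreeAlgebra S (Gen m) →ₐ[S] A)

open Classical in
/-- The element of the cyclotomic Hecke algebra attached to a slice: it vanishes if there are
strands to the left of the red line. -/
def Slice.val : Slice m → A
  | .strands B C σ _ => if B.IsPos ∧ C.IsPos then psi f (perm σ) else 0
  | .square B b pos => if B.IsPos then x f (B.pt.symm b) pos else 0

/-- The action of a slice on the free module over the cyclotomic Hecke algebra with basis the
configurations. -/
def sliceRep (g : Slice m) : Module.End S (Config m → A) :=
  matrixUnit S g.top g.bot (g.val f)

/-- The action of the free algebra. -/
def freeRep : FreeAlgebra S (Slice m) →ₐ[S] Module.End S (Config m → A) :=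
  FreeAlgebra.lift S (sliceRep f)

variable {f} {B C D : Config m}

theorem freeRep_ι (g : Slice m) : freeRep f (FreeAlgebra.ι S g) = sliceRep f g := by
  rw [freeRep, FreeAlgebra.lift_ι_apply]

theorem freeRep_str (σ : B.pts ≃ C.pts) (h : (crossings σ).Subsingleton)
    (hB : B.IsPos) (hC : C.IsPos) :
    freeRep f (str S σ h) = matrixUnit S C B (psi f (perm σ)) := by
  rw [freeRep_ι, sliceRep, Slice.val, if_pos ⟨hB, hC⟩]; rfl

theorem freeRep_str_of_not (σ : B.pts ≃ C.pts) (h : (crossings σ).Subsingleton)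
    (hBC : ¬ (B.IsPos ∧ C.IsPos)) : freeRep f (str S σ h) = 0 := by
  rw [freeRep_ι, sliceRep, Slice.val, if_neg hBC, matrixUnit.zero]

theorem freeRep_idem (hB : B.IsPos) : freeRep f (idem S B) = matrixUnit S B B (1 : A) := by
  rw [freeRep_str _ _ hB hB, perm_refl, psi_one]

theorem freeRep_sqs (b : B.pts) (p : Bool) (hB : B.IsPos) :
    freeRep f (sqs S B b p) = matrixUnit S B B (x f (B.pt.symm b) p) := by
  rw [freeRep_ι, sliceRep, Slice.val, if_pos hB]; rfl

theorem freeRep_sqs_of_not (b : B.pts) (p : Bool) (hB : ¬ B.IsPos) :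
    freeRep f (sqs S B b p) = 0 := by
  rw [freeRep_ι, sliceRep, Slice.val, if_neg hB, matrixUnit.zero]

theorem freeRep_idem_of_not (hB : ¬ B.IsPos) : freeRep f (idem S B) = 0 :=
  freeRep_str_of_not _ _ fun h => hB h.1

/-- A matching one of whose strands crosses the red line acts by zero. -/
theorem freeRep_str_of_red (σ : B.pts ≃ C.pts) (h : (crossings σ).Subsingleton) {a : B.pts}
    (ha : s(none, some a) ∈ crossings σ) : freeRep f (str S σ h) = 0 :=
  freeRep_str_of_not _ _ fun h => red_not_mem_crossings h.1 h.2 σ a ha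

/-- A crossing-free factor keeps every strand on its side of the red line, so the middle
configuration is non-violating once both ends are; its permutation is trivial, so its entry is 1. -/
theorem freeRep_comp (σ : B.pts ≃ C.pts) (τ : C.pts ≃ D.pts)
    (hσ : (crossings σ).Subsingleton) (hτ : (crossings τ).Subsingleton)
    (h : crossings σ = ∅ ∨ crossings τ = ∅) (hστ : (crossings (σ.trans τ)).Subsingleton) :
    freeRep f (str S τ hτ * str S σ hσ) = freeRep f (str S (σ.trans τ) hστ) := by
  rw [map_mul]
  by_cases hBD : B.IsPos ∧ D.IsPos
  · have hC : C.IsPos := by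
      rcases h with h | h
      · exact isPos_of_red_not_mem hBD.1 (σ := σ) (by simp [h])
      · exact isPos_of_red_not_mem' hBD.2 (σ := τ) (by simp [h])
    rw [freeRep_str τ hτ hC hBD.2, freeRep_str σ hσ hBD.1 hC, freeRep_str _ hστ hBD.1 hBD.2,
      matrixUnit.mul, perm_trans]
    rcases h with h | h <;> simp [perm_eq_one_of_crossings_eq_empty h, psi_one]
  · rw [freeRep_str_of_not _ hστ hBD]
    rw [not_and_or] at hBD
    rcases hBD with hB | hD
    · rw [freeRep_str_of_not σ hσ fun h => hB h.1, mul_zero]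
    · rw [freeRep_str_of_not τ hτ fun h => hD h.2, zero_mul]

theorem pt_map_extend (σ : B.pts ≃ C.pts) (i j : Fin m) :
    s(some (B.pt i), some (B.pt j)).map (extend σ)
      = s(some (C.pt (perm σ i)), some (C.pt (perm σ j))) := by
  simp [extend, pt_perm]

/-- A matching with the given single green crossing. -/
theorem exists_perm_eq_swap (hB : B.IsPos) (hC : C.IsPos) {σ : B.pts ≃ C.pts}
    {u : Sym2 B.Strand} (h : crossings σ = {u}) :
    ∃ (r : ℕ) (hr : r + 1 < m), perm σ = Equiv.swap ⟨r, Nat.lt_of_succ_lt hr⟩ ⟨r + 1, hr⟩ ∧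
      u = s(some (B.pt ⟨r, Nat.lt_of_succ_lt hr⟩), some (B.pt ⟨r + 1, hr⟩)) := by
  rcases perm_cases (σ := σ) (by simp [h]) with h1 | ⟨r, hr, h1⟩
  · have := crossings_eq_empty hB hC h1
    simp [h] at this
  · refine ⟨r, hr, h1, ?_⟩
    have := crossings_eq_singleton hB hC h1
    rwa [h, Set.singleton_eq_singleton_iff] at this

/-- The red line belongs to at most one of two disjoint crossings. If it belongs to u, then τ does
not cross it and C lies on the same side as D; otherwise σ does not cross it and C lies on the same
side as B. -/
theorem isPos_of_crossings_disjoint (hB : B.IsPos) (hD : D.IsPos) {σ : B.pts ≃ C.pts}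
    {τ : C.pts ≃ D.pts} {u v : Sym2 B.Strand} (huv : ∀ x ∈ u, x ∉ v) (h₁ : crossings σ = {u})
    (h₂ : crossings τ = {v.map (extend σ)}) : C.IsPos := by
  by_cases hu : none ∈ u
  · refine isPos_of_red_not_mem' hD (σ := τ) fun a ha => huv none hu ?_
    rw [h₂, Set.mem_singleton_iff] at ha
    have : none ∈ v.map (extend σ) := ha ▸ Sym2.mem_mk_left _ _
    obtain ⟨x, hx, hx'⟩ := Sym2.mem_map.mp this
    cases x with
    | none => exact hx
    | some x => simp [extend] at hx'
  · refine isPos_of_red_not_mem hB (σ := σ) fun a ha => hu ?_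
    rw [h₁, Set.mem_singleton_iff] at ha
    exact ha ▸ Sym2.mem_mk_left _ _

/-- A transposition of r and r + 1 does not renumber strands away from these two, so a distant
crossing keeps its number when moved past it. -/
theorem eq_of_map_extend_eq {σ : B.pts ≃ C.pts} {r s s' : ℕ} {hr : r + 1 < m} {hs : s + 1 < m}
    {hs' : s' + 1 < m}
    (h : perm σ = Equiv.swap ⟨r, Nat.lt_of_succ_lt hr⟩ ⟨r + 1, hr⟩)
    (h₁ : s ≠ r) (h₂ : s ≠ r + 1) (h₃ : s + 1 ≠ r)
    (h' : s(some (B.pt ⟨s, Nat.lt_of_succ_lt hs⟩), some (B.pt ⟨s + 1, hs⟩)).map (extend σ)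
      = s(some (C.pt ⟨s', Nat.lt_of_succ_lt hs'⟩), some (C.pt ⟨s' + 1, hs'⟩))) : s = s' := by
  rw [pt_map_extend, h, Equiv.swap_apply_of_ne_of_ne (by simpa) (by simpa),
    Equiv.swap_apply_of_ne_of_ne (by simpa) (by simpa)] at h'
  simp only [Sym2.eq_iff, Option.some_inj, EmbeddingLike.apply_eq_iff_eq, Fin.mk.injEq] at h'
  omega

/-- When both ends are non-violating, so are both middle configurations. The two orders then give
the same pair of distant simple transpositions, and the claim is that T_r and T_s commute. -/
theorem freeRep_far (hf : IsCyclotomic q P f) {C' : Config m} (σ : B.pts ≃ C.pts) (τ : C.pts ≃ D.pts)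
    (σ' : B.pts ≃ C'.pts) (τ' : C'.pts ≃ D.pts)
    (hσ : (crossings σ).Subsingleton) (hτ : (crossings τ).Subsingleton)
    (hσ' : (crossings σ').Subsingleton) (hτ' : (crossings τ').Subsingleton)
    (u v : Sym2 B.Strand) (huv : ∀ x ∈ u, x ∉ v)
    (h₁ : crossings σ = {u}) (h₂ : crossings τ = {v.map (extend σ)})
    (h₁' : crossings σ' = {v}) (h₂' : crossings τ' = {u.map (extend σ')}) :
    freeRep f (str S τ hτ * str S σ hσ) = freeRep f (str S τ' hτ' * str S σ' hσ') := by
  rw [map_mul, map_mul]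
  by_cases hBD : B.IsPos ∧ D.IsPos
  · obtain ⟨hB, hD⟩ := hBD
    have hC := isPos_of_crossings_disjoint hB hD huv h₁ h₂
    have hC' := isPos_of_crossings_disjoint hB hD (fun x hx hx' => huv x hx' hx) h₁' h₂'
    obtain ⟨r, hr, e1, rfl⟩ := exists_perm_eq_swap hB hC h₁
    obtain ⟨s, hs, e2, rfl⟩ := exists_perm_eq_swap hB hC' h₁'
    obtain ⟨s', hs', e3, h3⟩ := exists_perm_eq_swap hC hD h₂
    obtain ⟨r', hr', e4, h4⟩ := exists_perm_eq_swap hC' hD h₂'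
    simp only [Sym2.mem_iff, forall_eq_or_imp, forall_eq, Option.some_inj,
      EmbeddingLike.apply_eq_iff_eq, Fin.mk.injEq] at huv
    obtain rfl := eq_of_map_extend_eq e1 (by omega) (by omega) (by omega) h3
    obtain rfl := eq_of_map_extend_eq e2 (by omega) (by omega) (by omega) h4
    rw [freeRep_str σ hσ hB hC, freeRep_str τ hτ hC hD, freeRep_str σ' hσ' hB hC',
      freeRep_str τ' hτ' hC' hD, e1, e2, e3, e4, matrixUnit.mul, matrixUnit.mul,
      psi_swap, psi_swap]
    congr 1
    simp only [add_mul, mul_add, one_mul, mul_one,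
      hf.t_comm r s hr hs (by omega) (by omega)]
    abel
  · rw [not_and_or] at hBD
    rcases hBD with hB | hD
    · rw [freeRep_str_of_not σ hσ fun h => hB h.1, freeRep_str_of_not σ' hσ' fun h => hB h.1,
        mul_zero, mul_zero]
    · rw [freeRep_str_of_not τ hτ fun h => hD h.2, freeRep_str_of_not τ' hτ' fun h => hD h.2,
        zero_mul, zero_mul]

theorem freeRep_slide (hf : IsCyclotomic q P f) (σ : B.pts ≃ C.pts) (hσ : (crossings σ).Subsingleton)
    (b : B.pts) (p : Bool) (h : ∀ u ∈ crossings σ, some b ∉ u) :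
    freeRep f (sqs S C (σ b) p * str S σ hσ) = freeRep f (str S σ hσ * sqs S B b p) := by
  rw [map_mul, map_mul]
  by_cases hBC : B.IsPos ∧ C.IsPos
  · obtain ⟨hB, hC⟩ := hBC
    rw [freeRep_str σ hσ hB hC, freeRep_sqs _ _ hB, freeRep_sqs _ _ hC, matrixUnit.mul,
      matrixUnit.mul]
    congr 1
    obtain ⟨i, rfl⟩ := B.pt.surjective b
    rw [← pt_perm, OrderIso.symm_apply_apply, OrderIso.symm_apply_apply]
    rcases perm_cases hσ with h1 | ⟨r, hr, h1⟩
    · simp [h1, psi_one]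
    · have := h _ (swap_mem_crossings h1)
      simp only [Sym2.mem_iff, Option.some_inj, EmbeddingLike.apply_eq_iff_eq, not_or] at this
      rw [h1, Equiv.swap_apply_of_ne_of_ne this.1 this.2, psi_swap, mul_add, add_mul,
        hf.t_mul_x, one_mul, mul_one]
      · simpa [Fin.ext_iff] using this.1
      · simpa [Fin.ext_iff] using this.2
  · rw [freeRep_str_of_not σ hσ hBC, zero_mul, mul_zero]

theorem freeRep_swap (hB : B.IsPos) {r : ℕ} {hr : r + 1 < m}
    (h : (crossings (Equiv.swap (B.pt ⟨r, Nat.lt_of_succ_lt hr⟩)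
      (B.pt ⟨r + 1, hr⟩))).Subsingleton) :
    freeRep f (str S _ h) = matrixUnit S B B (t f r hr + 1) := by
  rw [freeRep_str _ _ hB hB, perm_swap, OrderIso.symm_apply_apply, OrderIso.symm_apply_apply,
    psi_swap]

/-- Over a violating configuration both sides vanish. Elsewhere the green relations become the Hecke
relations in ψ = T + 1, and every slice that meets the red line in a crossing acts by zero. -/
theorem freeRep_rel (hf : IsCyclotomic q P f) (hq : IsUnit q) {x y : FreeAlgebra S (Slice m)} (h : Rel m S q P x y) :
    freeRep f x = freeRep f y := by
  induction h with
  | mismatch g g' h =>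
    rw [map_mul, freeRep_ι, freeRep_ι, sliceRep, sliceRep, matrixUnit.mul_of_ne _ _ _ _ h, map_zero]
  | comp B C D σ τ hσ hτ h hστ => exact freeRep_comp σ τ hσ hτ h hστ
  | far B C C' D σ τ σ' τ' hσ hτ hσ' hτ' h u v huv h₁ h₂ h₁' h₂' =>
    exact freeRep_far hf σ τ σ' τ' hσ hτ hσ' hτ' u v huv h₁ h₂ h₁' h₂'
  | id_square B b p =>
    rw [map_mul]
    by_cases hB : B.IsPos
    · rw [freeRep_idem hB, freeRep_sqs _ _ hB, matrixUnit.mul, one_mul]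
    · rw [freeRep_sqs_of_not _ _ hB, mul_zero]
  | square_id B b p =>
    rw [map_mul]
    by_cases hB : B.IsPos
    · rw [freeRep_idem hB, freeRep_sqs _ _ hB, matrixUnit.mul, mul_one]
    · rw [freeRep_sqs_of_not _ _ hB, zero_mul]
  | square_comm B b c p p' =>
    rw [map_mul, map_mul]
    by_cases hB : B.IsPos
    · rw [freeRep_sqs _ _ hB, freeRep_sqs _ _ hB, matrixUnit.mul, matrixUnit.mul,
        hf.x_comm]
    · rw [freeRep_sqs_of_not _ _ hB, zero_mul, mul_zero]
  | slide B C σ hσ b p h => exact freeRep_slide hf σ hσ b p h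
  | square_inv B b p =>
    rw [map_mul]
    by_cases hB : B.IsPos
    · rw [freeRep_sqs _ _ hB, freeRep_sqs _ _ hB, freeRep_idem hB, matrixUnit.mul,
        hf.x_mul_x_not]
    · rw [freeRep_sqs_of_not _ _ hB, zero_mul, freeRep_idem_of_not hB]
  | hecke_top B a b hab h =>
    simp only [map_sub, map_mul, map_smul]
    by_cases hB : B.IsPos
    · obtain ⟨r, hr, rfl, rfl⟩ := exists_eq_pt_of_swap hab h
      simp only [freeRep_sqs _ _ hB, freeRep_swap hB, matrixUnit.mul, ← matrixUnit.sub,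
        ← matrixUnit.smul, OrderIso.symm_apply_apply]
      rw [mul_add_one_sub hq (hf.t_mul_self r hr) (hf.t_x_t r hr)]
    · simp [freeRep_sqs_of_not _ _ hB]
  | hecke_bot B a b hab h =>
    simp only [map_sub, map_mul, map_smul]
    by_cases hB : B.IsPos
    · obtain ⟨r, hr, rfl, rfl⟩ := exists_eq_pt_of_swap hab h
      simp only [freeRep_sqs _ _ hB, freeRep_swap hB, matrixUnit.mul, ← matrixUnit.sub,
        ← matrixUnit.smul, OrderIso.symm_apply_apply]
      rw [add_one_mul_sub hq (hf.t_mul_self r hr) (hf.t_x_t r hr)]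
    · simp [freeRep_sqs_of_not _ _ hB]
  | bigon B a b hab h =>
    simp only [map_mul, map_smul]
    by_cases hB : B.IsPos
    · obtain ⟨r, hr, rfl, rfl⟩ := exists_eq_pt_of_swap hab h
      rw [freeRep_swap hB, matrixUnit.mul, ← matrixUnit.smul,
        add_one_mul_add_one (hf.t_mul_self r hr)]
    · simp [freeRep_str_of_not _ h fun h => hB h.1]
  | triple B a b c hab hbc h h' =>
    simp only [map_sub, map_mul, map_smul]
    by_cases hB : B.IsPos
    · obtain ⟨r, hr, rfl, rfl⟩ := exists_eq_pt_of_swap hab h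
      obtain ⟨s, hs, hsr, rfl⟩ := exists_eq_pt_of_swap hbc h'
      simp only [EmbeddingLike.apply_eq_iff_eq, Fin.mk.injEq] at hsr
      subst hsr
      have e1 := freeRep_swap (f := f) hB h
      have e2 := freeRep_swap (f := f) (r := r + 1) (hr := hs) hB h'
      rw [e1, e2]
      simp only [matrixUnit.mul, ← matrixUnit.sub, ← matrixUnit.smul]
      rw [braid_add_one (hf.t_mul_self r hr) (hf.t_mul_self (r + 1) hs)
        (hf.t_braid r hr hs)]
    · simp [freeRep_str_of_not _ h fun h => hB h.1, freeRep_str_of_not _ h' fun h => hB h.1]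
  | red_bigon B C σ hσ hσ' a h =>
    have ha : s(none, some a) ∈ crossings σ := by simp [h]
    rw [map_mul, map_mul, freeRep_str_of_red σ hσ ha, mul_zero]
    by_cases hB : B.IsPos
    · have h0 := pt_symm_eq_zero hB h
      have hm : 0 < m := (B.pt.symm a).pos
      have h1 : B.pt.symm a = ⟨0, hm⟩ := Fin.ext h0
      rw [← Polynomial.aeval_algHom_apply, freeRep_sqs _ _ hB, freeRep_idem hB,
        matrixUnit.aeval_mul_one, h1, hf.cyc, matrixUnit.zero]
    · rw [freeRep_idem_of_not hB, mul_zero]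
  | red_square B C σ hσ a p h =>
    have ha : s(none, some a) ∈ crossings σ := by simp [h]
    rw [map_mul, map_mul, freeRep_str_of_red σ hσ ha, mul_zero, zero_mul]
  | red_through B C D ρ ρ' hρ hρ' a b hab hne h₁ h₂ h h' =>
    have ha : s(none, some a) ∈ crossings ρ := by simp [h₁]
    simp only [map_mul, freeRep_str_of_red ρ hρ ha, mul_zero, zero_mul]
  | red_triple B C D σ τ hσ hσ' hτ hτ' a b ha hb h₁ h₂ h h' =>
    -- The strand at a starts left of the red line, so B is violating and all terms vanish, the
    -- polynomial correction included.
    have hB : ¬ B.IsPos := fun hB => absurd ha (hB _ a.2).not_gt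
    simp only [map_sub, map_mul, map_sum, map_smul, freeRep_idem_of_not hB, mul_zero, smul_zero,
      Finset.sum_const_zero, freeRep_str_of_not σ hσ fun h => hB h.1,
      freeRep_str_of_not τ hτ fun h => hB h.1, sub_zero]

/-- The representation of the type F₁ Hecke algebra on the free module over the target of `f`
with basis the configurations. -/
def rep (hf : IsCyclotomic q P f) (hq : IsUnit q) :
    Alg m S q P →ₐ[S] Module.End S (Config m → A) :=
  RingQuot.liftAlgHom S ⟨RingQuot.liftAlgHom S ⟨freeRep f, fun _ _ h => freeRep_rel hf hq h⟩, by
    rintro _ _ ⟨B, hB⟩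
    rw [map_zero, AffineAlg.e, RingQuot.liftAlgHom_mkAlgHom_apply,
      freeRep_idem_of_not (Config.not_isPos.mpr hB)]⟩

theorem rep_slice (hf : IsCyclotomic q P f) (hq : IsUnit q) (g : Slice m) :
    rep hf hq (Alg.slice m S q P g) = freeRep f (FreeAlgebra.ι S g) := by
  rw [rep, Alg.slice, RingQuot.liftAlgHom_mkAlgHom_apply, RingQuot.liftAlgHom_mkAlgHom_apply]

end Rep

end TypeF

/-! ### The corner of an algebra at an idempotent. -/

/-- The corner of an algebra at an idempotent. -/
def CornerAlg {R : Type*} [Ring R] (e : R) (he : IsIdempotentElem e) : Type _ := he.Corner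

namespace CornerAlg

variable {S R : Type*} [CommRing S] [Ring R] [Algebra S R] {e : R} {he : IsIdempotentElem e}

instance : Ring (CornerAlg e he) := inferInstanceAs (Ring he.Corner)

/-- The underlying element of the algebra. -/
def val (a : CornerAlg e he) : R := Subtype.val a

theorem val_injective : Function.Injective (val : CornerAlg e he → R) := Subtype.val_injective

variable (he) in
/-- The element of the corner given by an element which is fixed by `e` on both sides. -/
def of (a : R) (h₁ : e * a = a) (h₂ : a * e = a) : CornerAlg e he :=
  ⟨a, (Subsemigroup.mem_corner_iff he).mpr ⟨h₁, h₂⟩⟩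

theorem mul_val (a : CornerAlg e he) : e * a.val = a.val :=
  ((Subsemigroup.mem_corner_iff he).mp (Subtype.property a)).1

theorem val_mul_self (a : CornerAlg e he) : a.val * e = a.val :=
  ((Subsemigroup.mem_corner_iff he).mp (Subtype.property a)).2

instance : SMul S (CornerAlg e he) :=
  ⟨fun c a => of he (c • a.val) (by rw [mul_smul_comm, mul_val])
    (by rw [smul_mul_assoc, val_mul_self])⟩

theorem val_mul (a b : CornerAlg e he) : (a * b).val = a.val * b.val := rfl
theorem val_zero : (0 : CornerAlg e he).val = 0 := rfl
theorem val_add (a b : CornerAlg e he) : (a + b).val = a.val + b.val := rfl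
theorem val_sub (a b : CornerAlg e he) : (a - b).val = a.val - b.val := rfl
theorem val_one : (1 : CornerAlg e he).val = e := rfl
theorem val_smul (c : S) (a : CornerAlg e he) : (c • a).val = c • a.val := rfl

/-- The unit is e, so the scalar c becomes c • e; hence the factor e in `val_pow` and `val_aeval`.
-/
instance : Algebra S (CornerAlg e he) where
  algebraMap :=
    { toFun := fun c => c • (1 : CornerAlg e he)
      map_one' := val_injective (one_smul S e)
      map_mul' := fun c d => val_injective (by
        simp only [val_mul, val_smul, val_one, smul_mul_smul_comm, he.eq])
      map_zero' := val_injective (zero_smul S e)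
      map_add' := fun c d => val_injective (add_smul c d e) }
  commutes' c a := val_injective (by
    change (c • e) * a.val = a.val * (c • e)
    rw [smul_mul_assoc, mul_smul_comm, mul_val, val_mul_self])
  smul_def' c a := val_injective (by
    change c • a.val = (c • e) * a.val
    rw [smul_mul_assoc, mul_val])

theorem val_algebraMap (c : S) : (algebraMap S (CornerAlg e he) c).val = c • e := rfl

theorem val_pow (a : CornerAlg e he) (n : ℕ) : (a ^ n).val = a.val ^ n * e := by
  induction n with
  | zero => rw [pow_zero, pow_zero, one_mul, val_one]
  | succ n ih => rw [pow_succ', val_mul, ih, pow_succ', mul_assoc]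

theorem val_aeval (a : CornerAlg e he) (p : S[X]) :
    (Polynomial.aeval a p).val = Polynomial.aeval a.val p * e := by
  induction p using Polynomial.induction_on' with
  | add p p' h h' => rw [map_add, map_add, add_mul, val_add, h, h']
  | monomial n c =>
    rw [Polynomial.aeval_monomial, Polynomial.aeval_monomial, ← Algebra.smul_def,
      ← Algebra.smul_def, val_smul, val_pow, smul_mul_assoc]

end CornerAlg

/-! ### Straight-line diagrams and vanishing diagrams in F. -/

namespace TypeF

open Hecke

variable {S : Type*} [CommRing S] {q : S} {m ℓ : ℕ} {P : Fin ℓ → S} {B C D E : Config m}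

section Crossings

/-- A matching that preserves the order has no green crossings, so only crossings with the red line
remain. -/
theorem crossings_subset_of_perm_eq_one {σ : B.pts ≃ C.pts} (hσ : perm σ = 1) {a : B.pts}
    (h : ∀ b : B.pts, (b : ℝ) * (σ b : ℝ) < 0 → b = a) : crossings σ ⊆ {s(none, some a)} := by
  intro u hu
  induction u using Sym2.ind with
  | _ x y =>
    match x, y with
    | none, none => exact absurd hu (not_mem_crossings_self σ none)
    | none, some b => rw [h b ((mem_crossings_red σ b).mp hu)]; rfl
    | some b, none =>
      rw [Sym2.eq_swap] at hu ⊢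
      rw [h b ((mem_crossings_red σ b).mp hu)]; rfl
    | some b, some c =>
      obtain ⟨i, rfl⟩ := B.pt.surjective b
      obtain ⟨j, rfl⟩ := B.pt.surjective c
      rw [mem_crossings_green, hσ] at hu
      rcases hu with h | h
      · exact absurd h.1 h.2.not_gt
      · exact absurd h.1 h.2.not_gt

/-- The leftmost strand may be moved across the red line. -/
theorem exists_red_crossing (hB : B.IsPos) (hm : 0 < m) :
    ∃ (C : Config m) (σ : B.pts ≃ C.pts), ¬ C.IsPos ∧ (crossings σ.symm).Subsingleton ∧
      crossings σ = {s(none, some (B.pt ⟨0, hm⟩))} := by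
  set z : Fin m := ⟨0, hm⟩
  have hneg : (-1 : ℝ) ∉ B.pts.erase (B.pt z) := fun h =>
    absurd (hB _ (Finset.mem_of_mem_erase h)) (by norm_num)
  -- The leftmost point is replaced by -1 and the others stay; the order-preserving matching then
  -- crosses the red line once and nothing else.
  let C : Config m :=
    { pts := insert (-1) (B.pts.erase (B.pt z))
      card_pts := by
        rw [Finset.card_insert_of_notMem hneg, Finset.card_erase_of_mem (B.pt z).2, B.card_pts]
        omega
      zero_notMem := by
        intro h
        rcases Finset.mem_insert.mp h with h | h
        · norm_num at h
        · exact absurd (hB _ (Finset.mem_of_mem_erase h)) (lt_irrefl _) }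
  have hC : ∀ c : C.pts, (c : ℝ) = -1 ∨ 0 < (c : ℝ) := fun c => by
    rcases Finset.mem_insert.mp c.2 with h | h
    · exact Or.inl h
    · exact Or.inr (hB _ (Finset.mem_of_mem_erase h))
  have h0 : (C.pt z : ℝ) = -1 := by
    obtain ⟨j, hj⟩ := C.pt.surjective ⟨-1, Finset.mem_insert_self _ _⟩
    have h1 : C.pt z ≤ C.pt j := C.pt.monotone (Fin.le_def.mpr (Nat.zero_le _))
    rw [hj, ← Subtype.coe_le_coe] at h1
    rcases hC (C.pt z) with h | h
    · exact h
    · change (C.pt z : ℝ) ≤ -1 at h1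
      linarith
  have hi : ∀ i, ((C.pt i : C.pts) : ℝ) < 0 → i = z := fun i hi => by
    rcases hC (C.pt i) with h | h
    · exact C.pt.injective (Subtype.ext (h.trans h0.symm))
    · exact absurd h hi.not_gt
  have hσ : ∀ i, ofPerm B C 1 (B.pt i) = C.pt i := fun i => by rw [← pt_perm, perm_ofPerm]; rfl
  have hpos : ∀ i, (0 : ℝ) < B.pt i := fun i => hB _ (B.pt i).2
  refine ⟨C, ofPerm B C 1, fun h => ?_, ?_, ?_⟩
  · have := h _ (C.pt z).2
    rw [h0] at this
    norm_num at this
  · have hp : perm (ofPerm B C 1).symm = 1 := by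
      ext i; simp [perm, ofPerm, Equiv.Perm.one_def]
    refine (Set.subsingleton_singleton (a := s(none, some (C.pt z)))).anti
      (crossings_subset_of_perm_eq_one hp fun b hb => ?_)
    obtain ⟨i, rfl⟩ := C.pt.surjective b
    rw [← hσ, Equiv.symm_apply_apply, hσ] at hb
    rw [hi i (neg_of_mul_neg_left hb (hpos i).le)]
  · refine (Set.Nonempty.subset_singleton_iff ⟨s(none, some (B.pt z)), ?_⟩).mp
      (crossings_subset_of_perm_eq_one (perm_ofPerm 1) fun b hb => ?_)
    · rw [mem_crossings_red, hσ, h0]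
      linarith [hpos z]
    · obtain ⟨i, rfl⟩ := B.pt.surjective b
      rw [hσ] at hb
      rw [hi i (neg_of_mul_neg_right hb (hpos i).le)]

end Crossings

section Diagrams

variable (S q P) in
/-- The projection from the free algebra on slices to the type F₁ Hecke algebra. -/
def Alg.mk : FreeAlgebra S (Slice m) →ₐ[S] Alg m S q P :=
  (RingQuot.mkAlgHom S (Violating m S q P)).comp (RingQuot.mkAlgHom S (Rel m S q P))

theorem Alg.mk_rel {a b : FreeAlgebra S (Slice m)} (h : Rel m S q P a b) :
    Alg.mk S q P a = Alg.mk S q P b := by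
  simp only [Alg.mk, AlgHom.comp_apply, RingQuot.mkAlgHom_rel S h]

theorem mk_idem_eq_zero (hB : ¬ B.IsPos) : Alg.mk S q P (idem S B) = 0 := by
  have := RingQuot.mkAlgHom_rel S
    (Violating.violating (S := S) (q := q) (P := P) B (Config.not_isPos.mp hB))
  rw [map_zero] at this
  exact this

theorem mk_idem_mul_str (σ : B.pts ≃ C.pts) (h : (crossings σ).Subsingleton) :
    Alg.mk S q P (idem S C) * Alg.mk S q P (str S σ h) = Alg.mk S q P (str S σ h) := by
  rw [← map_mul]
  exact Alg.mk_rel (Rel.comp B C C σ (Equiv.refl _) h (subsingleton_refl C)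
    (Or.inr (crossings_refl C)) h)

theorem mk_str_mul_idem (σ : B.pts ≃ C.pts) (h : (crossings σ).Subsingleton) :
    Alg.mk S q P (str S σ h) * Alg.mk S q P (idem S B) = Alg.mk S q P (str S σ h) := by
  rw [← map_mul]
  exact Alg.mk_rel (Rel.comp B B C (Equiv.refl _) σ (subsingleton_refl B) h
    (Or.inl (crossings_refl B)) h)

theorem mk_idem_mul_sqs (b : B.pts) (p : Bool) :
    Alg.mk S q P (idem S B) * Alg.mk S q P (sqs S B b p) = Alg.mk S q P (sqs S B b p) := by
  rw [← map_mul]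
  exact Alg.mk_rel (Rel.id_square B b p)

theorem mk_sqs_mul_idem (b : B.pts) (p : Bool) :
    Alg.mk S q P (sqs S B b p) * Alg.mk S q P (idem S B) = Alg.mk S q P (sqs S B b p) := by
  rw [← map_mul]
  exact Alg.mk_rel (Rel.square_id B b p)

/-- A diagram absorbs the idempotents at both of its ends, and a violating one is zero in F. -/
theorem mk_str_eq_zero (σ : B.pts ≃ C.pts) (h : (crossings σ).Subsingleton)
    (hBC : ¬ (B.IsPos ∧ C.IsPos)) : Alg.mk S q P (str S σ h) = 0 := by
  rw [not_and_or] at hBC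
  rcases hBC with hB | hC
  · rw [← mk_str_mul_idem, mk_idem_eq_zero hB, mul_zero]
  · rw [← mk_idem_mul_str, mk_idem_eq_zero hC, zero_mul]

theorem slice_eq_zero (g : Slice m) (hg : ¬ (g.bot.IsPos ∧ g.top.IsPos)) :
    Alg.slice m S q P g = 0 := by
  cases g with
  | strands B C σ h => exact mk_str_eq_zero σ h hg
  | square B b p =>
    have hB : ¬ B.IsPos := fun h => hg ⟨h, h⟩
    have := mk_sqs_mul_idem (S := S) (q := q) (P := P) b p
    rw [mk_idem_eq_zero hB, mul_zero] at this
    exact this.symm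

/-- A diagram with an end to the left of the red line vanishes. -/
theorem IsDiagram.eq_zero {x : Alg m S q P} (hx : IsDiagram m S q P B C x)
    (hBC : ¬ (B.IsPos ∧ C.IsPos)) : x = 0 := by
  induction hx with
  | slice g => exact slice_eq_zero g hBC
  | stack B C D x y _ _ ihx ihy =>
    by_cases hB : B.IsPos
    · rw [ihy fun h => hBC ⟨hB, h.2⟩, zero_mul]
    · rw [ihx fun h => hB h.1, mul_zero]

variable (S q P) in
open Classical in
/-- The straight-line diagram inducing a given permutation of the numbers of the strands. -/
def cr (B C : Config m) (π : Equiv.Perm (Fin m)) : Alg m S q P :=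
  -- The value 0 never occurs for a simple π between configurations right of the red line. Indexing
  -- by permutations keeps proofs about crossings out of the products.
  if h : (crossings (ofPerm B C π)).Subsingleton then Alg.mk S q P (str S _ h) else 0

variable (S q P) in
/-- The square or inverse square on the strand with number `i`. -/
def sqA (B : Config m) (i : Fin m) (p : Bool) : Alg m S q P := Alg.mk S q P (sqs S B (B.pt i) p)

theorem mk_str (σ : B.pts ≃ C.pts) (h : (crossings σ).Subsingleton) :
    Alg.mk S q P (str S σ h) = cr S q P B C (perm σ) := by
  obtain ⟨π, rfl⟩ : ∃ π, σ = ofPerm B C π := ⟨perm σ, (ofPerm_perm σ).symm⟩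
  rw [perm_ofPerm, cr, dif_pos h]

theorem mk_idem : Alg.mk S q P (idem S B) = cr S q P B B 1 := by
  rw [mk_str, perm_refl]

/-- A trivial permutation or a simple transposition. -/
def IsSimple (π : Equiv.Perm (Fin m)) : Prop :=
  π = 1 ∨ ∃ (r : ℕ) (h : r + 1 < m), π = Equiv.swap ⟨r, Nat.lt_of_succ_lt h⟩ ⟨r + 1, h⟩

theorem isSimple_one : IsSimple (1 : Equiv.Perm (Fin m)) := Or.inl rfl

theorem isSimple_swap (r : ℕ) (h : r + 1 < m) :
    IsSimple (Equiv.swap (⟨r, Nat.lt_of_succ_lt h⟩ : Fin m) ⟨r + 1, h⟩) := Or.inr ⟨r, h, rfl⟩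

theorem IsSimple.subsingleton {π : Equiv.Perm (Fin m)} (hπ : IsSimple π) (hB : B.IsPos)
    (hC : C.IsPos) : (crossings (ofPerm B C π)).Subsingleton :=
  crossings_subsingleton hB hC (by rw [perm_ofPerm]; exact hπ)

theorem cr_eq {π : Equiv.Perm (Fin m)} (hπ : IsSimple π) (hB : B.IsPos) (hC : C.IsPos) :
    cr S q P B C π = Alg.mk S q P (str S _ (hπ.subsingleton hB hC)) := by
  rw [mk_str, perm_ofPerm]

theorem cr_mul {π ρ : Equiv.Perm (Fin m)} (hπ : IsSimple π) (hρ : IsSimple ρ)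
    (h : π = 1 ∨ ρ = 1) (hB : B.IsPos) (hC : C.IsPos) (hD : D.IsPos) :
    cr S q P C D ρ * cr S q P B C π = cr S q P B D (ρ * π) := by
  have hπρ : IsSimple (ρ * π) := by rcases h with rfl | rfl <;> simpa
  have key : ((ofPerm B C π).trans (ofPerm C D ρ)) = ofPerm B D (ρ * π) :=
    perm_injective (by simp)
  have hsub : (crossings ((ofPerm B C π).trans (ofPerm C D ρ))).Subsingleton := by
    rw [key]; exact hπρ.subsingleton hB hD
  have hempty : crossings (ofPerm B C π) = ∅ ∨ crossings (ofPerm C D ρ) = ∅ :=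
    h.imp (fun h => crossings_eq_empty hB hC (by rwa [perm_ofPerm]))
      fun h => crossings_eq_empty hC hD (by rwa [perm_ofPerm])
  rw [cr_eq hπ hB hC, cr_eq hρ hC hD, ← map_mul, Alg.mk_rel (Rel.comp B C D _ _ _ _ hempty hsub),
    mk_str, key, perm_ofPerm]

theorem sqA_mul_cr {π : Equiv.Perm (Fin m)} {i : Fin m} (hB : B.IsPos) (hC : C.IsPos)
    (h : π = 1 ∨ ∃ (r : ℕ) (h : r + 1 < m), π = Equiv.swap ⟨r, Nat.lt_of_succ_lt h⟩ ⟨r + 1, h⟩ ∧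
      (i : ℕ) ≠ r ∧ (i : ℕ) ≠ r + 1) (p : Bool) :
    sqA S q P C i p * cr S q P B C π = cr S q P B C π * sqA S q P B i p := by
  have hπ : IsSimple π := h.imp_right fun ⟨r, hr, h, _⟩ => ⟨r, hr, h⟩
  have hi : π i = i := by
    rcases h with rfl | ⟨r, hr, rfl, h1, h2⟩
    · rfl
    · exact Equiv.swap_apply_of_ne_of_ne (by simpa [Fin.ext_iff]) (by simpa [Fin.ext_iff])
  have key : ofPerm B C π (B.pt i) = C.pt i := by rw [← pt_perm, perm_ofPerm, hi]
  rw [cr_eq hπ hB hC, sqA, sqA, ← key, ← map_mul, ← map_mul]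
  refine Alg.mk_rel (Rel.slide B C _ _ _ p fun u hu => ?_)
  rcases h with h | ⟨r, hr, h, h1, h2⟩
  · rw [crossings_eq_empty hB hC (by simpa)] at hu
    exact absurd hu (Set.notMem_empty _)
  · rw [crossings_eq_singleton hB hC (by simpa), Set.mem_singleton_iff] at hu
    subst hu
    simp [Fin.ext_iff, h1, h2]

/-- This is the isotopy `Rel.far` with all configurations equal to B: neither transposition
renumbers the strands that cross in the other. -/
theorem cr_comm (hB : B.IsPos) {r s : ℕ} {hr : r + 1 < m} {hs : s + 1 < m} (h₁ : r ≠ s)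
    (h₂ : r ≠ s + 1) (h₃ : s ≠ r + 1) :
    cr S q P B B (Equiv.swap ⟨s, Nat.lt_of_succ_lt hs⟩ ⟨s + 1, hs⟩)
        * cr S q P B B (Equiv.swap ⟨r, Nat.lt_of_succ_lt hr⟩ ⟨r + 1, hr⟩)
      = cr S q P B B (Equiv.swap ⟨r, Nat.lt_of_succ_lt hr⟩ ⟨r + 1, hr⟩)
        * cr S q P B B (Equiv.swap ⟨s, Nat.lt_of_succ_lt hs⟩ ⟨s + 1, hs⟩) := by
  rw [cr_eq (isSimple_swap r hr) hB hB, cr_eq (isSimple_swap s hs) hB hB, ← map_mul, ← map_mul]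
  refine Alg.mk_rel (Rel.far B B B B _ _ _ _ _ _ _ _ (perm_injective ?_) _ _ ?_
    (crossings_eq_singleton hB hB (perm_ofPerm _)) ?_
    (crossings_eq_singleton hB hB (perm_ofPerm _)) ?_)
  · ext i
    simp only [perm_trans, perm_ofPerm, Equiv.Perm.mul_apply, Equiv.swap_apply_def]
    grind
  · simp only [Sym2.mem_iff, forall_eq_or_imp, forall_eq, Option.some_inj,
      EmbeddingLike.apply_eq_iff_eq, Fin.mk.injEq]
    omega
  · rw [crossings_eq_singleton hB hB (perm_ofPerm _), pt_map_extend, perm_ofPerm,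
      Equiv.swap_apply_of_ne_of_ne, Equiv.swap_apply_of_ne_of_ne] <;> simp <;> omega
  · rw [crossings_eq_singleton hB hB (perm_ofPerm _), pt_map_extend, perm_ofPerm,
      Equiv.swap_apply_of_ne_of_ne, Equiv.swap_apply_of_ne_of_ne] <;> simp <;> omega

theorem pt_lt_pt_succ (r : ℕ) (hr : r + 1 < m) :
    B.pt ⟨r, Nat.lt_of_succ_lt hr⟩ < B.pt ⟨r + 1, hr⟩ :=
  B.pt.lt_iff_lt.mpr (by simp)

theorem swap_subsingleton (hB : B.IsPos) (r : ℕ) (hr : r + 1 < m) :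
    (crossings (Equiv.swap (B.pt ⟨r, Nat.lt_of_succ_lt hr⟩)
      (B.pt ⟨r + 1, hr⟩))).Subsingleton :=
  crossings_subsingleton hB hB (Or.inr ⟨r, hr, by simp⟩)

theorem mk_swap (hB : B.IsPos) (r : ℕ) (hr : r + 1 < m) :
    Alg.mk S q P (str S _ (swap_subsingleton hB r hr))
      = cr S q P B B (Equiv.swap ⟨r, Nat.lt_of_succ_lt hr⟩ ⟨r + 1, hr⟩) := by
  rw [mk_str, perm_swap, OrderIso.symm_apply_apply, OrderIso.symm_apply_apply]

variable (S q P B) in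
theorem isIdempotentElem_e : IsIdempotentElem (Alg.mk S q P (idem S B)) :=
  mk_idem_mul_str _ _

end Diagrams

end TypeF

/-! ### The isomorphism with the corner at a non-violating configuration. -/

namespace TypeF

open Hecke CornerAlg

variable {S : Type*} [CommRing S] {q : S} {m ℓ : ℕ} {P : Fin ℓ → S} {B C D : Config m}

variable (S q P B) in
/-- The corner of the type F₁ Hecke algebra at the idempotent `e_B`. -/
abbrev EndAlg : Type _ :=
  CornerAlg (R := Alg m S q P) (Alg.mk S q P (idem S B)) (isIdempotentElem_e S q P B)

variable (S q P B) in
/-- The square or inverse square on the strand with number `i` in the corner at `e_B`. -/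
def sqE (i : Fin m) (p : Bool) : EndAlg S q P B :=
  of _ (sqA S q P B i p) (mk_idem_mul_sqs _ _) (mk_sqs_mul_idem _ _)

variable (S q P) in
/-- The crossing of the strands with numbers `r` and `r + 1` in the corner at `e_B`. -/
def crE (hB : B.IsPos) (r : ℕ) (hr : r + 1 < m) : EndAlg S q P B :=
  of _ (Alg.mk S q P (str S _ (swap_subsingleton hB r hr))) (mk_idem_mul_str _ _)
    (mk_str_mul_idem _ _)

theorem val_crE (hB : B.IsPos) (r : ℕ) (hr : r + 1 < m) : (crE S q P hB r hr).val
    = cr S q P B B (Equiv.swap ⟨r, Nat.lt_of_succ_lt hr⟩ ⟨r + 1, hr⟩) := mk_swap hB r hr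

/-- Pull the leftmost strand across the red line and back. The bigon relation turns this into
p(X_1)e_B, while the diagram factors through a violating configuration and so is zero in F. -/
theorem aeval_sqE (hB : B.IsPos) (hm : 0 < m) :
    Polynomial.aeval (sqE S q P B ⟨0, hm⟩ true) (cycPoly P) = 0 := by
  obtain ⟨C, σ, hC, hσ', hσ⟩ := exists_red_crossing hB hm
  have hsub : (crossings σ).Subsingleton := by rw [hσ]; exact Set.subsingleton_singleton
  have := Alg.mk_rel (Rel.red_bigon (S := S) (q := q) (P := P) B C σ hsub hσ' _ hσ)
  rw [map_mul, map_mul, mk_str_eq_zero σ hsub fun h => hC h.2, mul_zero,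
    ← Polynomial.aeval_algHom_apply] at this
  apply val_injective
  rw [val_aeval]
  exact this.symm

theorem exists_isCyclotomic_corner (hB : B.IsPos) :
    ∃ f : FreeAlgebra S (Gen m) →ₐ[S] EndAlg S q P B, IsCyclotomic q P f ∧
      (∀ i b, x f i b = sqE S q P B i b) ∧ ∀ r h, t f r h = crE S q P hB r h - (1 : EndAlg S q P B) := by
  refine exists_isCyclotomic (sqE S q P B) (crE S q P hB) (fun i b => ?_) (fun i j b b' => ?_)
    (fun r h => ?_) (fun r h => ?_) (fun r h h' => ?_) (fun r h s h₁ h₂ => ?_)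
    (fun r s h h' h₁ h₂ h₃ => ?_) (aeval_sqE hB)
  · have := Alg.mk_rel (Rel.square_inv (S := S) (q := q) (P := P) B (B.pt i) b)
    rw [map_mul] at this
    exact val_injective this
  · have := Alg.mk_rel (Rel.square_comm (S := S) (q := q) (P := P) B (B.pt i) (B.pt j) b b')
    rw [map_mul, map_mul] at this
    exact val_injective this
  · have := Alg.mk_rel (Rel.bigon (q := q) (P := P) B _ _ (pt_lt_pt_succ r h)
      (swap_subsingleton hB r h))
    rw [map_mul, map_smul] at this
    exact val_injective this
  · have := Alg.mk_rel (Rel.hecke_top (q := q) (P := P) B _ _ (pt_lt_pt_succ r h)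
      (swap_subsingleton hB r h))
    rw [map_sub, map_sub, map_mul, map_mul, map_smul] at this
    exact val_injective this
  · have := Alg.mk_rel (Rel.triple (q := q) (P := P) B _ _ _ (pt_lt_pt_succ r h)
      (pt_lt_pt_succ (r + 1) h') (swap_subsingleton hB r h) (swap_subsingleton hB (r + 1) h'))
    rw [map_sub, map_sub, map_mul, map_mul, map_mul, map_mul, map_smul, map_smul] at this
    exact val_injective this
  · apply val_injective
    rw [val_mul, val_mul, val_crE]
    exact (sqA_mul_cr hB hB (Or.inr ⟨r, h, rfl, h₁, h₂⟩) true).symm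
  · apply val_injective
    rw [val_mul, val_mul, val_crE, val_crE]
    exact (cr_comm hB h₁ h₂ h₃).symm

/-- The image of a in the corner acts with single entry f a, so it determines f a. With f the
projection to the cyclotomic Hecke algebra this gives injectivity. -/
theorem rep_val {A : Type*} [Ring A] [Algebra S A] {f : FreeAlgebra S (Gen m) →ₐ[S] A}
    {g : FreeAlgebra S (Gen m) →ₐ[S] EndAlg S q P B} (hf : IsCyclotomic q P f) (hq : IsUnit q)
    (hB : B.IsPos) (hx : ∀ i b, x g i b = sqE S q P B i b)
    (ht : ∀ r h, t g r h = crE S q P hB r h - (1 : EndAlg S q P B))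
    (a : FreeAlgebra S (Gen m)) : rep hf hq (g a).val = matrixUnit S B B (f a) := by
  have hidem : rep hf hq (Alg.mk S q P (idem S B)) = matrixUnit S B B (1 : A) :=
    (rep_slice hf hq (Slice.strands B B (Equiv.refl _) (subsingleton_refl B))).trans
      (freeRep_idem hB)
  have hsq : ∀ i p, rep hf hq (x g i p).val = matrixUnit S B B (x f i p) := fun i p => by
    have := (rep_slice hf hq (Slice.square B (B.pt i) p)).trans (freeRep_sqs (B.pt i) p hB)
    rw [OrderIso.symm_apply_apply] at this
    rw [hx]
    exact this
  induction a using FreeAlgebra.induction with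
  | grade0 c =>
    rw [AlgHom.commutes, AlgHom.commutes, val_algebraMap, map_smul, hidem,
      Algebra.algebraMap_eq_smul_one, matrixUnit.smul]
  | grade1 y =>
    cases y with
    | X i => exact hsq i true
    | Xinv i => exact hsq i false
    | T r h =>
      have hcr : rep hf hq (crE S q P hB r h).val = matrixUnit S B B (t f r h + 1) :=
        (rep_slice hf hq (Slice.strands B B _ (swap_subsingleton hB r h))).trans
          (freeRep_swap hB (swap_subsingleton hB r h))
      change rep hf hq (t g r h).val = matrixUnit S B B (t f r h)
      rw [ht, val_sub, map_sub, hcr, val_one, hidem, ← matrixUnit.sub, add_sub_cancel_right]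
  | mul a b ha hb => rw [map_mul, map_mul, val_mul, map_mul, ha, hb, matrixUnit.mul]
  | add a b ha hb => rw [map_add, map_add, val_add, map_add, ha, hb, matrixUnit.add]

section Generated

variable {g : FreeAlgebra S (Gen m) →ₐ[S] EndAlg S q P B}

/-- Every diagram between configurations to the right of the red line comes from the cyclotomic
Hecke algebra. -/
theorem IsDiagram.exists_eq (hB : B.IsPos)
    (hx : ∀ i b, x g i b = sqE S q P B i b)
    (ht : ∀ r h, t g r h = crE S q P hB r h - (1 : EndAlg S q P B))
    {y : Alg m S q P} (hy : IsDiagram m S q P C D y) (hC : C.IsPos) (hD : D.IsPos) :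
    ∃ a, y = cr S q P B D 1 * (g a).val * cr S q P C B 1 := by
  induction hy with
  | slice s =>
    cases s with
    | strands C D σ h =>
      have hC : C.IsPos := hC
      have hD : D.IsPos := hD
      have hπ : IsSimple (perm σ) := perm_cases h
      obtain ⟨a, ha⟩ : ∃ a, (g a).val = cr S q P B B (perm σ) := by
        rcases hπ with h1 | ⟨r, hr, h1⟩
        · exact ⟨1, by rw [map_one, val_one, h1, mk_idem]⟩
        · refine ⟨gen S (Gen.T r hr) + 1, ?_⟩
          rw [map_add, map_one]
          change (t g r hr + 1).val = _
          rw [ht, sub_add_cancel, val_crE, h1]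
      refine ⟨a, (mk_str σ h).trans ?_⟩
      change _ = cr S q P B D 1 * (g a).val * cr S q P C B 1
      rw [ha, cr_mul hπ isSimple_one (Or.inr rfl) hB hB hD,
        cr_mul isSimple_one (by simpa) (Or.inl rfl) hC hB hD, one_mul, mul_one]
    | square C c p =>
      obtain ⟨i, rfl⟩ := C.pt.surjective c
      change C.IsPos at hC
      refine ⟨gen S (if p then Gen.X i else Gen.Xinv i), ?_⟩
      change sqA S q P C i p = cr S q P B C 1 * (x g i p).val * cr S q P C B 1
      rw [hx]
      change sqA S q P C i p = cr S q P B C 1 * sqA S q P B i p * cr S q P C B 1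
      rw [← sqA_mul_cr hB hC (Or.inl rfl), mul_assoc,
        cr_mul isSimple_one isSimple_one (Or.inl rfl) hC hB hC, mul_one, ← mk_idem]
      exact (mk_sqs_mul_idem _ _).symm
  | stack C D E y z hy hz ihy ihz =>
    by_cases hD' : D.IsPos
    · obtain ⟨a, rfl⟩ := ihy hC hD'
      obtain ⟨b, rfl⟩ := ihz hD' hD
      refine ⟨b * a, ?_⟩
      -- Between two transported factors the strands go from B to D and back without crossing, which
      -- straightens to e_B.
      have h1 : cr S q P D B 1 * cr S q P B D 1 = Alg.mk S q P (idem S B) := by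
        rw [cr_mul isSimple_one isSimple_one (Or.inl rfl) hB hD' hB, mul_one, mk_idem]
      calc _ = cr S q P B E 1 * (g b).val * ((cr S q P D B 1 * cr S q P B D 1) * (g a).val)
            * cr S q P C B 1 := by simp only [mul_assoc]
        _ = _ := by rw [h1, mul_val, map_mul, val_mul, mul_assoc (cr S q P B E 1)]
    · exact ⟨0, by rw [hy.eq_zero fun h => hD' h.2, mul_zero, map_zero, val_zero, mul_zero,
        zero_mul]⟩

end Generated

variable (P) in
/-- The cyclotomic Hecke algebra is the subalgebra of the type F₁ Hecke algebra attached to a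
collection of configurations with exactly one member to the right of the red line. -/
theorem exists_cyclotomic_equiv_sub (hq : IsUnit q) {𝒟 : Set (Config m)} (hB𝒟 : B ∈ 𝒟)
    (hB : B.IsPos) (h𝒟 : ∀ C ∈ 𝒟, C.IsPos → C = B) :
    ∃ f : Cyclotomic S q m P ≃+* Sub m S q P 𝒟, ∀ (c : S) a, f (c • a) = c • f a := by
  obtain ⟨f, hf, hx, ht⟩ := exists_isCyclotomic_corner (S := S) (q := q) (P := P) hB
  obtain ⟨g, hg⟩ := hf.exists_lift
  -- Surjectivity: a spanning diagram with a violating end is zero, and the others begin and end at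
  -- B, where the transporting diagrams are e_B itself.
  have hspan : ∀ y ∈ Sub m S q P 𝒟, ∃ a, (f a).val = y := by
    intro y hy
    induction hy using Submodule.span_induction with
    | mem y hy =>
      obtain ⟨C, hC, D, hD, hy⟩ := hy
      by_cases h : C.IsPos ∧ D.IsPos
      · obtain ⟨a, rfl⟩ := hy.exists_eq hB hx ht h.1 h.2
        obtain rfl := h𝒟 C hC h.1
        obtain rfl := h𝒟 D hD h.2
        exact ⟨a, by rw [← mk_idem, mul_val, val_mul_self]⟩
      · exact ⟨0, by rw [hy.eq_zero h, map_zero, val_zero]⟩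
    | zero => exact ⟨0, by rw [map_zero, val_zero]⟩
    | add y z _ _ hy hz =>
      obtain ⟨a, rfl⟩ := hy
      obtain ⟨b, rfl⟩ := hz
      exact ⟨a + b, by rw [map_add, val_add]⟩
    | smul c y _ hy =>
      obtain ⟨a, rfl⟩ := hy
      exact ⟨c • a, by rw [map_smul, val_smul]⟩
  have hslice : ∀ s : Slice m, s.bot = B → s.top = B → Alg.slice m S q P s ∈ Sub m S q P 𝒟 :=
    fun s h₁ h₂ => Submodule.subset_span
      ⟨s.bot, h₁ ▸ hB𝒟, s.top, h₂ ▸ hB𝒟, IsDiagram.slice s⟩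
  have hmem : ∀ a, (f a).val ∈ Sub m S q P 𝒟 := by
    intro a
    have h1 : Alg.mk S q P (idem S B) ∈ Sub m S q P 𝒟 :=
      hslice (Slice.strands B B (Equiv.refl _) (subsingleton_refl B)) rfl rfl
    have hsq : ∀ i p, (x f i p).val ∈ Sub m S q P 𝒟 := fun i p => by
      rw [hx]
      exact hslice (Slice.square B (B.pt i) p) rfl rfl
    induction a using FreeAlgebra.induction with
    | grade0 c =>
      rw [AlgHom.commutes, val_algebraMap]
      exact (Sub m S q P 𝒟).toSubmodule.smul_mem c h1
    | grade1 y =>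
      cases y with
      | X i => exact hsq i true
      | Xinv i => exact hsq i false
      | T r h =>
        change (t f r h).val ∈ _
        rw [ht, sub_eq_add_neg, ← neg_one_smul S, val_add, val_smul]
        exact add_mem (hslice (Slice.strands B B _ (swap_subsingleton hB r h)) rfl rfl)
          ((Sub m S q P 𝒟).toSubmodule.smul_mem _ h1)
    | mul a b ha hb => rw [map_mul, val_mul]; exact mul_mem ha hb
    | add a b ha hb => rw [map_add, val_add]; exact add_mem ha hb
  have hmem' : ∀ a, (g a).val ∈ Sub m S q P 𝒟 := fun a => by
    obtain ⟨a, rfl⟩ := Cyclotomic.mk_surjective a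
    rw [hg]
    exact hmem a
  let φ : Cyclotomic S q m P →ₙ+* Sub m S q P 𝒟 :=
    { toFun := fun a => ⟨(g a).val, hmem' a⟩
      map_mul' := fun a b => Subtype.ext (congrArg val (map_mul g a b))
      map_zero' := Subtype.ext (congrArg val (map_zero g))
      map_add' := fun a b => Subtype.ext (congrArg val (map_add g a b)) }
  have hφ : Function.Bijective φ := by
    refine ⟨fun a b hab => ?_, fun y => ?_⟩
    · have h1 : (g a).val = (g b).val := congrArg (fun y : Sub m S q P 𝒟 => y.1) hab
      obtain ⟨a, rfl⟩ := Cyclotomic.mk_surjective a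
      obtain ⟨b, rfl⟩ := Cyclotomic.mk_surjective b
      rw [hg, hg] at h1
      -- Injectivity: in the representation over the cyclotomic Hecke algebra itself, the two
      -- elements become entries of equal matrix units.
      have h2 := congrArg (rep Cyclotomic.isCyclotomic_mk hq) h1
      rw [rep_val Cyclotomic.isCyclotomic_mk hq hB hx ht,
        rep_val Cyclotomic.isCyclotomic_mk hq hB hx ht] at h2
      exact matrixUnit.injective B B h2
    · obtain ⟨a, ha⟩ := hspan y y.2
      exact ⟨Cyclotomic.mk S q m P a, Subtype.ext ((congrArg val (hg a)).trans ha)⟩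
  exact ⟨RingEquiv.ofBijective φ hφ, fun c a => Subtype.ext (congrArg val (map_smul g c a))⟩

end TypeF

/-! ### The deformed parameter and the two cases of the theorem. -/

namespace Deformed

variable {𝕜 : Type*} [Field 𝕜]

/-- The series d has constant term 1, hence is invertible, and substitution is an algebra
homomorphism, so it preserves units. -/
theorem isUnit_qPar (ℓ : ℕ) {q : 𝕜} (hq : q ≠ 0) {d : PowerSeries 𝕜}
    (hd : PowerSeries.constantCoeff d = 1) : IsUnit (qPar ℓ q d) := by
  refine IsUnit.mul ((IsUnit.mk0 q hq).map MvPowerSeries.C) ?_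
  have hs : PowerSeries.HasSubst (MvPowerSeries.X none : Base 𝕜 ℓ) := PowerSeries.HasSubst.X none
  rw [← PowerSeries.coe_substAlgHom hs]
  refine IsUnit.map _ ?_
  rw [PowerSeries.isUnit_iff_constantCoeff, hd]
  exact isUnit_one

end Deformed

end

theorem mainTheorem10 {𝕜 : Type*} [Field 𝕜] (q : 𝕜) (hq0 : q ≠ 0) (hq1 : q ≠ 1)
    (m ℓ : ℕ) (Q : Fin ℓ → 𝕜) (hQ : ∀ i, Q i ≠ 0)
    -- the sets of `𝒟°`: an arbitrary choice of one set with `i` points left of the red line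
    -- and `m - i` points right of it, for each `i = 0, …, m`
    (B : Fin (m + 1) → TypeF.Config m) (hB : ∀ i, (B i).numLeft = (i : ℕ)) :
    -- the deformed algebras over `𝕜[[h, z_1, …, z_ℓ]]`, in characteristic zero
    (∀ [CharZero 𝕜] (d : PowerSeries 𝕜), PowerSeries.constantCoeff d = 1 →
      ∃ f : Hecke.Cyclotomic (Deformed.Base 𝕜 ℓ) (Deformed.qPar ℓ q d) m (Deformed.QPar Q) ≃+*
          TypeF.Sub m (Deformed.Base 𝕜 ℓ) (Deformed.qPar ℓ q d) (Deformed.QPar Q) (Set.range B),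
        ∀ (c : Deformed.Base 𝕜 ℓ) x, f (c • x) = c • f x) ∧
    -- the undeformed algebras over `𝕜`, in arbitrary characteristic
    (∃ f : Hecke.Cyclotomic 𝕜 q m Q ≃+* TypeF.Sub m 𝕜 q Q (Set.range B),
      ∀ (c : 𝕜) x, f (c • x) = c • f x) := by
  have hpos : (B 0).IsPos := TypeF.Config.isPos_iff_numLeft.mpr (hB 0)
  -- B_i has exactly i points left of the red line, so only B_0 is non-violating.
  have huniq : ∀ C ∈ Set.range B, C.IsPos → C = B 0 := by
    rintro _ ⟨i, rfl⟩ hi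
    rw [TypeF.Config.isPos_iff_numLeft, hB] at hi
    rw [Fin.ext (a := i) (b := 0) hi]
  exact ⟨fun d hd => TypeF.exists_cyclotomic_equiv_sub _ (Deformed.isUnit_qPar ℓ hq0 hd)
      (Set.mem_range_self 0) hpos huniq,
    TypeF.exists_cyclotomic_equiv_sub _ (IsUnit.mk0 q hq0) (Set.mem_range_self 0) hpos huniq⟩
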